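/- Let $\mathbb X$ and $\Theta$ be Polish spaces, or more generally Borel subsets of Polish spaces (for instance of $\mathbb R^d$ and $\mathbb R^p$), with their Borel $\sigma$-fields. Let $\mu$ be a $\sigma$-finite measure on $\mathbb X$, and let $f(x\mid\theta)\ge 0$ be jointly measurable on $\mathbb X\times\Theta$ with $\int f(x\mid\theta)\,d\mu(x)=1$ for every $\theta$. For a probability measure $G$ on $\Theta$ put $f_G(x)=\int_\Theta f(x\mid\theta)\,dG(\theta)$. Let $(\alpha_n)_{n\ge1}$ be any sequence of real numbers in $(0,1)$, let $G_0$ be a probability measure on $\Theta$ and, given data $x_1,x_2,\dots$, define recursively for $n\ge1$ $$G_n(A)=(1-\alpha_n)\,G_{n-1}(A)+\alpha_n\,\frac{\int_A f(x_n\mid\theta)\,dG_{n-1}(\theta)}{\int_\Theta f(x_n\mid\theta)\,dG_{n-1}(\theta)}$$ (with $G_n=G_{n-1}$ when the denominator is $0$ or $\infty$, which has probability zero below). Let $((X_n,\theta_n))_{n\ge1}$ be random variables with values in $\mathbb X\times\Theta$ on a probability space with probability $P$ such that, for every $n\ge 0$, * the conditional distribution of $X_{n+1}$ given $(X_{1:n},\theta_{n+1})$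 has density $f(\cdot\mid\theta_{n+1})$ with respect to $\mu$ (as holds, in particular, if this is the conditional distribution given $X_{1:n}$ together with $\theta_1,\dots,\theta_{n+1}$ or the whole sequence $(\theta_k)$); * the conditional distribution of $\theta_{n+1}$ given $X_{1:n}$ is $G_n$, computed from $X_{1:n}$ (for $n=0$: $\theta_1\sim G_0$). A random probability measure $F$ is the *directing random measure* of a sequence $(Z_n)$ if the empirical distributions $\frac1n\sum_{i=1}^n\delta_{Z_i}$ converge weakly to $F$ almost surely. A sequence $(X_n)$ is *asymptotically exchangeable with directing random measure* $F$ if $(X_{n+1},X_{n+2},\dots)$ converges in distribution, as $n\to\infty$, to an exchangeable sequence $(Z_1,Z_2,\dots)$ whose directing random measure has the same law as $F$. Then: 1. $(X_n)$ is conditionally identically distributed: for all $n\ge0$, $k\ge1$ and all bounded measurable $h:\mathbb X\to\mathbb R$, $E[h(X_{n+k})\mid X_{1:n}]=E[h(X_{n+1})\mid X_{1:n}]$ a.s. 2. For every $n\ge0$ the conditional distribution of $X_{n+1}$ given $X_{1:n}$ has density $f_{G_n}$ with respect to $\mu$. There is a random probability measure $G$ on $\Theta$ such that, $P$-a.s.,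 $G_n\to G$ weakly and $f_{G_n}\to f_G$ in $L^1(\mu)$, that is, $\int|f_{G_n}-f_G|\,d\mu\to0$. 3. Let $F_G$ be the random probability measure with density $f_G$ with respect to $\mu$. Then $F_G$ is the directing random measure of $(X_n)$, and $(X_n)$ is asymptotically exchangeable with directing random measure $F_G$. -/

import Mathlib

open MeasureTheory ProbabilityTheory Filter Topology
open scoped ENNReal NNReal

noncomputable section

namespace NewtonModel

/-! Time is shifted by one: `X n` and `θ n` (`n = 0, 1, …`) stand for the `(n+1)`-st observation and
the `(n+1)`-st latent parameter, and `α n` for the `(n+1)`-st weight.  Thus `X 0, …, X (n - 1)` are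
the first `n` observations `X_{1:n}`. -/

section General

variable {Ω S : Type*}

/-- The σ-algebra generated by the first `n` variables `X 0, …, X (n - 1)`
(trivial for `n = 0`). -/
abbrev pastSigma [MeasurableSpace S] (X : ℕ → Ω → S) (n : ℕ) : MeasurableSpace Ω :=
  MeasurableSpace.comap (fun ω (i : Fin n) => X i ω) inferInstance

/-- `κ` is a version of the conditional distribution of `Y` given the σ-algebra `m`:
`P(Y ∈ B | m) = κ(B)` almost surely, for every measurable set `B`. -/
def HasCondLaw (m : MeasurableSpace Ω) [MeasurableSpace Ω] [MeasurableSpace S]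
    (Y : Ω → S) (κ : Ω → Measure S) (P : Measure Ω) : Prop :=
  ∀ B : Set S, MeasurableSet B → P⟦Y ⁻¹' B | m⟧ =ᵐ[P] fun ω => (κ ω).real B

/-- Conditionally identically distributed sequence (with respect to its natural filtration):
for all bounded measurable `h`, all `n ≥ 0` and all future times,
`E[h(X_{n+k}) | X_{1:n}] = E[h(X_{n+1}) | X_{1:n}]` almost surely. -/
def IsCID [MeasurableSpace Ω] [MeasurableSpace S] (X : ℕ → Ω → S) (P : Measure Ω) : Prop :=
  (∀ n, Measurable (X n)) ∧
    ∀ (n k : ℕ) (h : S → ℝ), Measurable h → (∃ C : ℝ, ∀ s, |h s| ≤ C) →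
      P[fun ω => h (X (n + k) ω) | pastSigma X n]
        =ᵐ[P] P[fun ω => h (X n ω) | pastSigma X n]

/-- Exchangeable sequence: every finite initial segment has a permutation-invariant law. -/
def IsExchangeable [MeasurableSpace Ω] [MeasurableSpace S]
    (Z : ℕ → Ω → S) (P : Measure Ω) : Prop :=
  ∀ (n : ℕ) (σ : Equiv.Perm (Fin n)),
    IdentDistrib (fun ω (i : Fin n) => Z (σ i) ω) (fun ω (i : Fin n) => Z i ω) P P

/-- The empirical distribution of `x 0, …, x n`. -/
def empirical [MeasurableSpace S] (x : ℕ → S) (n : ℕ) : ProbabilityMeasure S :=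
  ⟨((n : ℝ≥0∞) + 1)⁻¹ • ∑ i ∈ Finset.range (n + 1), Measure.dirac (x i), ⟨by
    have h0 : ((n : ℝ≥0∞) + 1) ≠ 0 := by simp
    have h1 : ((n : ℝ≥0∞) + 1) ≠ ∞ := by simp
    simp [ENNReal.inv_mul_cancel h0 h1]⟩⟩

/-- The random probability measure `F` is the directing random measure of the sequence `Z`:
it is the almost sure weak limit of the empirical distributions of `Z`. -/
def IsDirectingMeasure [MeasurableSpace Ω] [MeasurableSpace S] [TopologicalSpace S]
    [OpensMeasurableSpace S] (F : Ω → ProbabilityMeasure S) (Z : ℕ → Ω → S)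
    (P : Measure Ω) : Prop :=
  Measurable F ∧ ∀ᵐ ω ∂P, Tendsto (fun n => empirical (fun i => Z i ω) n) atTop (𝓝 (F ω))

/-- `X` is asymptotically exchangeable with directing random measure `F`: the shifted sequences
`(X n, X (n + 1), …)` converge in distribution, as `n → ∞`, to an exchangeable sequence whose
directing random measure is distributed as `F`.  The limit sequence is realised as the coordinate
process on the space of sequences under its law `Q`. -/
def IsAsymptoticallyExchangeable [MeasurableSpace Ω] [MeasurableSpace S] [TopologicalSpace S]
    [SecondCountableTopology S] [OpensMeasurableSpace S] (X : ℕ → Ω → S)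
    (F : Ω → ProbabilityMeasure S) (P : Measure Ω) [IsProbabilityMeasure P] : Prop :=
  ∃ Q : ProbabilityMeasure (ℕ → S),
    IsExchangeable (fun (i : ℕ) (z : ℕ → S) => z i) (Q : Measure (ℕ → S)) ∧
    (∃ F' : (ℕ → S) → ProbabilityMeasure S,
      IsDirectingMeasure F' (fun (i : ℕ) (z : ℕ → S) => z i) (Q : Measure (ℕ → S)) ∧
      IdentDistrib F' F (Q : Measure (ℕ → S)) P) ∧
    TendstoInDistribution (fun (n : ℕ) (ω : Ω) (i : ℕ) => X (n + i) ω) atTop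
      (fun z : ℕ → S => z) (fun _ => P) (Q : Measure (ℕ → S))

end General

section Newton

variable {𝕏 Θ : Type*} [MeasurableSpace 𝕏] [MeasurableSpace Θ]

/-- `f x t` is a mixture kernel `f(x ∣ t)`: jointly measurable, and for every `t ∈ Θ` a probability
density in `x` with respect to `μ`. -/
structure IsMixtureKernel (f : 𝕏 → Θ → ℝ≥0) (μ : Measure 𝕏) : Prop where
  measurable : Measurable (Function.uncurry f)
  lintegral_eq_one : ∀ t : Θ, ∫⁻ x, f x t ∂μ = 1

/-- The mixture density `f_G(x) = ∫ f(x ∣ t) dG(t)`. -/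
def mixDensity (f : 𝕏 → Θ → ℝ≥0) (G : ProbabilityMeasure Θ) (x : 𝕏) : ℝ≥0∞ :=
  ∫⁻ t, f x t ∂(G : Measure Θ)

open Classical in
/-- The posterior distribution `A ↦ ∫_A f(x ∣ t) dG(t) / ∫ f(x ∣ t) dG(t)`.  The quotient makes
sense when `0 < f_G(x) < ∞`; at the other points `x`, a null set for the law `f_G dμ`, it is set
equal to `G`. -/
def posterior (f : 𝕏 → Θ → ℝ≥0) (G : ProbabilityMeasure Θ) (x : 𝕏) : ProbabilityMeasure Θ :=
  if h : mixDensity f G x ≠ 0 ∧ mixDensity f G x ≠ ∞ then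
    ⟨(mixDensity f G x)⁻¹ • (G : Measure Θ).withDensity (fun t => f x t), ⟨by
      rw [Measure.smul_apply, withDensity_apply _ MeasurableSet.univ, Measure.restrict_univ,
        smul_eq_mul]
      exact ENNReal.inv_mul_cancel h.1 h.2⟩⟩
  else G

/-- One step of Newton's recursion with weight `a ∈ (0,1)`:
`(1 - a) G + a · posterior(G, x)`. -/
def newtonStep (f : 𝕏 → Θ → ℝ≥0) (a : Set.Ioo (0 : ℝ) 1) (G : ProbabilityMeasure Θ) (x : 𝕏) :
    ProbabilityMeasure Θ :=
  ⟨ENNReal.ofReal (1 - a) • (G : Measure Θ) + ENNReal.ofReal a • (posterior f G x : Measure Θ), ⟨by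
    rw [Measure.add_apply, Measure.smul_apply, Measure.smul_apply, measure_univ, measure_univ,
      smul_eq_mul, smul_eq_mul, mul_one, mul_one,
      ← ENNReal.ofReal_add (sub_nonneg.2 a.2.2.le) a.2.1.le]
    simp⟩⟩

/-- Newton's recursive estimate `G_n`, computed from the first `n` terms of the data `x`. -/
def newtonSeq (f : 𝕏 → Θ → ℝ≥0) (α : ℕ → Set.Ioo (0 : ℝ) 1) (G₀ : ProbabilityMeasure Θ)
    (x : ℕ → 𝕏) : ℕ → ProbabilityMeasure Θ
  | 0 => G₀
  | n + 1 => newtonStep f (α n) (newtonSeq f α G₀ x n) (x n)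

/-- The process `((X n, θ n))` satisfies Newton's model under `P`:
* given the past observations and the current parameter `θ n`, the observation `X n` has density
  `f(· ∣ θ n)` with respect to `μ` (conditional independence from further variables, such as the
  past parameters, is not needed, and not required);
* given the past observations `X 0, …, X (n - 1)`, the parameter `θ n` has distribution `G_n`,
  computed from them by Newton's recursion; in particular `θ 0` has distribution `G₀`. -/
structure IsNewtonModel {Ω : Type*} [MeasurableSpace Ω] (P : Measure Ω) (μ : Measure 𝕏)
    (f : 𝕏 → Θ → ℝ≥0) (α : ℕ → Set.Ioo (0 : ℝ) 1) (G₀ : ProbabilityMeasure Θ)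
    (X : ℕ → Ω → 𝕏) (θ : ℕ → Ω → Θ) : Prop where
  measurable_obs : ∀ n, Measurable (X n)
  measurable_param : ∀ n, Measurable (θ n)
  obs_law : ∀ n, HasCondLaw (pastSigma X n ⊔ MeasurableSpace.comap (θ n) inferInstance) (X n)
    (fun ω => μ.withDensity (fun x => f x (θ n ω))) P
  param_law : ∀ n, HasCondLaw (pastSigma X n) (θ n)
    (fun ω => (newtonSeq f α G₀ (fun i => X i ω) n : Measure Θ)) P

end Newton

end NewtonModel

end

set_option linter.unusedSectionVars false

/-! The mechanism is a martingale. Given the past, the next observation is drawn from the density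
`f_{G_n}`, and averaging the posterior of `G_n` over that density gives back `G_n` by Tonelli
(`lintegral_lintegral_posterior`). A Newton step is a convex combination of `G_n` and its posterior,
so for each measurable `φ` with values in `[0, 1]` the integrals `∫ φ dG_n` form a bounded
martingale, whatever the weights (`IsNewtonModel.martingale_lintegral_newtonSeq`). Taking `φ t = P(X
∈ B ∣ t)`, the predictive probabilities are martingales too; with the tower property this gives
conditional identity in distribution.

Martingale convergence gives an almost sure limit of `G_n(B)` for each `B` separately, with a null
set depending on `B`. `exists_measurable_ae_tendsto_apply` assembles these limits into one random
probability measure `G`: on the line through distribution functions at rational points, in general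
through a Borel embedding. The mean of `G_n` is constantly `G₀`, which prevents loss of mass and
upgrades inequalities to almost sure equalities. Setwise convergence, one set at a time, is stronger
than what weak convergence alone offers, and this matters because `f(x ∣ ·)` is only measurable. It
yields Fatou's inequality `f_G(x) ≤ liminf f_{G_n}(x)` for each `x`, almost surely; exchanging the
quantifiers over `ω` and `x` and applying Scheffé's lemma gives convergence in `L¹(μ)`.

The predictive laws of the observations then converge setwise to `F_G`. A strong law for martingale
differences transfers this limit to the empirical distributions (`ae_tendsto_empirical_apply`). For
asymptotic exchangeability, the next `k` observations are replaced one at a time by their predictive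
probabilities, frozen at time `n` (`tendsto_integral_prod_indicator_sub`); box probabilities
therefore converge to those of a sequence that is i.i.d. given `F_G`. -/

namespace NewtonModel

/-! ### Setwise limits of random probability measures -/

section RandomMeasures

variable {Ω S : Type*} [MeasurableSpace Ω] [MeasurableSpace S] {P : Measure Ω}

/-- Almost sure setwise convergence of random probability measures, one set at a time, implies
almost sure weak convergence. -/
theorem ae_tendsto_of_forall_ae_tendsto_apply [TopologicalSpace S] [SecondCountableTopology S]
    [OpensMeasurableSpace S] {H : ℕ → Ω → ProbabilityMeasure S} {L : Ω → ProbabilityMeasure S}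
    (h : ∀ B, MeasurableSet B → ∀ᵐ ω ∂P,
      Tendsto (fun n => (H n ω : Measure S) B) atTop (𝓝 ((L ω : Measure S) B))) :
    ∀ᵐ ω ∂P, Tendsto (fun n => H n ω) atTop (𝓝 (L ω)) := by
  set b := TopologicalSpace.countableBasis S
  have hb : b.Countable := TopologicalSpace.countable_countableBasis S
  have hbas := TopologicalSpace.isBasis_countableBasis S
  -- Finite intersections of a countable base form a countable π-system, so a single null set serves
  -- for all of them.
  set C : Set (Set S) := (fun f => ⋂₀ f) '' {f | f.Finite ∧ f ⊆ b} with hC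
  have hCc : C.Countable := (Set.countable_ofPred_finite_subset hb).image _
  have hCm : ∀ s ∈ C, MeasurableSet s := by
    rintro s ⟨f, ⟨hf, hfb⟩, rfl⟩
    exact (hf.isOpen_sInter fun u hu => hbas.isOpen (hfb hu)).measurableSet
  have hpi : IsPiSystem C := by
    rintro s ⟨f, ⟨hf, hfb⟩, rfl⟩ t ⟨g, ⟨hg, hgb⟩, rfl⟩ -
    exact ⟨f ∪ g, ⟨hf.union hg, Set.union_subset hfb hgb⟩, Set.sInter_union f g⟩
  have hae : ∀ᵐ ω ∂P, ∀ s ∈ C,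
      Tendsto (fun n => (H n ω : Measure S) s) atTop (𝓝 ((L ω : Measure S) s)) :=
    (ae_ball_iff hCc).2 fun s hs => h s (hCm s hs)
  filter_upwards [hae] with ω hω
  refine hpi.tendsto_probabilityMeasure_of_tendsto_of_mem hCm ?_ ?_
  · intro u hu x hx
    obtain ⟨v, hv, hxv, hvu⟩ := hbas.exists_subset_of_mem_open hx hu
    refine ⟨v, ⟨{v}, ⟨Set.finite_singleton v, by simpa using hv⟩, by simp⟩,
      (hbas.isOpen hv).mem_nhds hxv, hvu⟩
  · intro s hs
    exact (ENNReal.tendsto_toNNReal (measure_ne_top _ s)).comp (hω s hs)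

/-- Fatou's lemma for random probability measures that converge setwise. -/
theorem ae_lintegral_le_liminf_of_forall_ae_tendsto_apply
    {H : ℕ → Ω → ProbabilityMeasure S} {L : Ω → ProbabilityMeasure S}
    (h : ∀ B, MeasurableSet B → ∀ᵐ ω ∂P,
      Tendsto (fun n => (H n ω : Measure S) B) atTop (𝓝 ((L ω : Measure S) B)))
    {g : S → ℝ≥0∞} (hg : Measurable g) :
    ∀ᵐ ω ∂P, ∫⁻ t, g t ∂(L ω : Measure S)
      ≤ liminf (fun n => ∫⁻ t, g t ∂(H n ω : Measure S)) atTop := by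
  -- The simple approximations of `g` involve only countably many level sets, so their null sets can
  -- be united.
  have hae : ∀ᵐ ω ∂P, ∀ k : ℕ, ∀ y ∈ (SimpleFunc.eapprox g k).range,
      Tendsto (fun n => (H n ω : Measure S) (SimpleFunc.eapprox g k ⁻¹' {y})) atTop
        (𝓝 ((L ω : Measure S) (SimpleFunc.eapprox g k ⁻¹' {y}))) :=
    ae_all_iff.2 fun k => (Finset.eventually_all _).2 fun y _ =>
      h _ (SimpleFunc.measurableSet_fiber _ y)
  filter_upwards [hae] with ω hω
  rw [lintegral_eq_iSup_eapprox_lintegral hg]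
  refine iSup_le fun k => ?_
  have ht : Tendsto (fun n => (SimpleFunc.eapprox g k).lintegral (H n ω : Measure S)) atTop
      (𝓝 ((SimpleFunc.eapprox g k).lintegral (L ω : Measure S))) := by
    refine tendsto_finsetSum _ fun y hy => ?_
    refine ENNReal.Tendsto.const_mul (hω k y hy) (Or.inr ?_)
    obtain ⟨x, rfl⟩ := SimpleFunc.mem_range.1 hy
    exact (SimpleFunc.eapprox_lt_top g k x).ne
  rw [← ht.liminf_eq]
  refine liminf_le_liminf (Eventually.of_forall fun n => ?_)
  rw [← SimpleFunc.lintegral_eq_lintegral]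
  refine lintegral_mono fun x => ?_
  rw [← SimpleFunc.iSup_eapprox_apply hg x]
  exact le_iSup (fun k => SimpleFunc.eapprox g k x) k

theorem measurable_map_probabilityMeasure {T : Type*} [MeasurableSpace T] {k : S → T}
    (hk : Measurable k) {K : Ω → ProbabilityMeasure S} (hK : Measurable K) :
    Measurable fun ω => (K ω).map hk.aemeasurable :=
  ((Measure.measurable_map k hk).comp (measurable_subtype_coe.comp hK)).subtype_mk

section RealLine

variable [IsProbabilityMeasure P] {ν : Measure ℝ} [IsProbabilityMeasure ν]
  {H : ℕ → Ω → ProbabilityMeasure ℝ}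

/-- Random probability measures on the real line with constant mean measure, whose values at each
Borel set converge almost surely, converge setwise to a random probability measure. -/
theorem exists_measurable_ae_tendsto_apply_real (hH : ∀ n, Measurable (H n))
    (hmean : ∀ n B, MeasurableSet B → ∫⁻ ω, (H n ω : Measure ℝ) B ∂P = ν B)
    (hconv : ∀ B, MeasurableSet B → ∀ᵐ ω ∂P,
      ∃ c, Tendsto (fun n => (H n ω : Measure ℝ) B) atTop (𝓝 c)) :
    ∃ L : Ω → ProbabilityMeasure ℝ, Measurable L ∧ ∀ B, MeasurableSet B → ∀ᵐ ω ∂P,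
      Tendsto (fun n => (H n ω : Measure ℝ) B) atTop (𝓝 ((L ω : Measure ℝ) B)) := by
  have hHB : ∀ n B, MeasurableSet B → Measurable fun ω => (H n ω : Measure ℝ) B := fun n B hB =>
    (Measure.measurable_coe hB).comp (measurable_subtype_coe.comp (hH n))
  -- The upper limit exists everywhere, is measurable in `ω`, bounded by one and monotone in `B`;
  -- almost surely it is the limit.
  set c : Set ℝ → Ω → ℝ≥0∞ := fun B ω => limsup (fun n => (H n ω : Measure ℝ) B) atTop with hc
  have hcm : ∀ B, MeasurableSet B → Measurable (c B) := fun B hB =>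
    Measurable.limsup fun n => hHB n B hB
  have hct : ∀ B, MeasurableSet B → ∀ᵐ ω ∂P,
      Tendsto (fun n => (H n ω : Measure ℝ) B) atTop (𝓝 (c B ω)) := by
    intro B hB
    filter_upwards [hconv B hB] with ω ⟨d, hd⟩
    simpa only [hc, hd.limsup_eq] using hd
  have hint_lim : ∀ B, MeasurableSet B → ∀ g : Ω → ℝ≥0∞,
      (∀ᵐ ω ∂P, Tendsto (fun n => (H n ω : Measure ℝ) B) atTop (𝓝 (g ω))) →
      ∫⁻ ω, g ω ∂P = ν B := by
    intro B hB g hg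
    have h1 := tendsto_lintegral_of_dominated_convergence (μ := P) (fun _ => 1)
      (fun n => hHB n B hB) (fun n => Eventually.of_forall fun ω => prob_le_one) (by simp) hg
    simp only [hmean _ B hB] at h1
    exact tendsto_nhds_unique h1 tendsto_const_nhds |>.symm ▸ rfl
  have hcint : ∀ B, MeasurableSet B → ∫⁻ ω, c B ω ∂P = ν B := fun B hB =>
    hint_lim B hB _ (hct B hB)
  have hcle : ∀ B ω, c B ω ≤ 1 := fun B ω =>
    limsup_le_of_le (by isBoundedDefault) (Eventually.of_forall fun n => prob_le_one)
  have hcmono : ∀ ω, Monotone fun q : ℚ => c (Set.Iic (q : ℝ)) ω := fun ω q r hqr =>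
    limsup_le_limsup (Eventually.of_forall fun n =>
      measure_mono (Set.Iic_subset_Iic.2 (by exact_mod_cast hqr)))
  -- The supremum is at most one and its mean is at least `ν (Iic q)` for every `q`, hence one; so
  -- it equals one almost surely.
  have htop : ∀ᵐ ω ∂P, ⨆ q : ℚ, c (Set.Iic (q : ℝ)) ω = 1 := by
    refine ae_eq_of_ae_le_of_lintegral_le (g := fun _ => 1)
      (Eventually.of_forall fun ω => iSup_le fun q => hcle _ ω) ?_ aemeasurable_const ?_
    · exact ((lintegral_mono fun ω => iSup_le fun q : ℚ => hcle (Set.Iic (q : ℝ)) ω).trans_lt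
        (by simp : ∫⁻ _ : Ω, 1 ∂P < ∞)).ne
    · have h1 : Tendsto (fun q : ℚ => ν (Set.Iic (q : ℝ))) atTop (𝓝 1) := by
        have := (tendsto_measure_Iic_atTop ν).comp (tendsto_ratCast_atTop_iff (R := ℝ) |>.2 tendsto_id)
        simpa [Function.comp_def] using this
      rw [lintegral_const, measure_univ, mul_one]
      refine le_of_tendsto' h1 fun q => ?_
      rw [← hcint _ measurableSet_Iic]
      exact lintegral_mono fun ω => le_iSup (fun q : ℚ => c (Set.Iic (q : ℝ)) ω) q
  have hbot : ∀ᵐ ω ∂P, ⨅ q : ℚ, c (Set.Iic (q : ℝ)) ω = 0 := by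
    have hm : Measurable fun ω => ⨅ q : ℚ, c (Set.Iic (q : ℝ)) ω :=
      Measurable.iInf fun q => hcm _ measurableSet_Iic
    refine (lintegral_eq_zero_iff hm).1 (le_antisymm ?_ zero_le)
    have h1 : Tendsto (fun q : ℚ => ν (Set.Iic (q : ℝ))) atBot (𝓝 0) := by
      have := ENNReal.tendsto_ofReal ((tendsto_cdf_atBot ν).comp
        (tendsto_ratCast_atBot_iff (R := ℝ) |>.2 tendsto_id))
      simpa [ofReal_cdf] using this
    refine ge_of_tendsto' h1 fun q => ?_
    rw [← hcint _ measurableSet_Iic]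
    exact lintegral_mono fun ω => iInf_le (fun q : ℚ => c (Set.Iic (q : ℝ)) ω) q
  -- Monotonicity gives one inequality; right continuity of the distribution function of `ν` makes
  -- the means agree, which forces equality.
  have hright : ∀ᵐ ω ∂P, ∀ q : ℚ,
      ⨅ r : Set.Ioi q, c (Set.Iic ((r : ℚ) : ℝ)) ω = c (Set.Iic (q : ℝ)) ω := by
    refine ae_all_iff.2 fun q => EventuallyEq.symm ?_
    have hm : Measurable fun ω => ⨅ r : Set.Ioi q, c (Set.Iic ((r : ℚ) : ℝ)) ω :=
      Measurable.iInf fun r => hcm _ measurableSet_Iic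
    refine ae_eq_of_ae_le_of_lintegral_le
      (Eventually.of_forall fun ω => le_iInf fun r => hcmono ω r.2.le) ?_ hm.aemeasurable ?_
    · rw [hcint _ measurableSet_Iic]; exact measure_ne_top _ _
    · rw [hcint _ measurableSet_Iic, ← ofReal_cdf]
      have hle : ∀ r : Set.Ioi q, ∫⁻ ω, ⨅ r : Set.Ioi q, c (Set.Iic ((r : ℚ) : ℝ)) ω ∂P
          ≤ ENNReal.ofReal (cdf ν ((r : ℚ) : ℝ)) := fun r => by
        rw [ofReal_cdf, ← hcint _ measurableSet_Iic]
        exact lintegral_mono fun ω =>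
          iInf_le (fun r : Set.Ioi q => c (Set.Iic ((r : ℚ) : ℝ)) ω) r
      have hq1 : (q + 1 : ℚ) ∈ Set.Ioi q := by simp
      have hfin := ne_top_of_le_ne_top ENNReal.ofReal_ne_top (hle ⟨q + 1, hq1⟩)
      rw [← ENNReal.ofReal_toReal hfin]
      refine ENNReal.ofReal_le_ofReal ?_
      rw [← (cdf ν).iInf_rat_gt_eq (q : ℝ)]
      have : Nonempty { r' : ℚ // (q : ℝ) < r' } := ⟨⟨q + 1, by push_cast; linarith⟩⟩
      refine le_ciInf fun r => ?_
      exact ENNReal.toReal_le_of_le_ofReal (cdf_nonneg ν _) (hle ⟨r, by exact_mod_cast r.2⟩)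
  set M : Ω → ℚ → ℝ := fun ω q => (c (Set.Iic (q : ℝ)) ω).toReal with hM
  have hMm : Measurable M := measurable_pi_iff.2 fun q => (hcm _ measurableSet_Iic).ennreal_toReal
  have hne : ∀ B ω, c B ω ≠ ∞ := fun B ω => ne_top_of_le_ne_top ENNReal.one_ne_top (hcle B ω)
  have hpt : ∀ᵐ ω ∂P, IsRatStieltjesPoint M ω := by
    filter_upwards [htop, hbot, hright] with ω h1 h0 hr
    refine ⟨fun q r hqr => ENNReal.toReal_mono (hne _ _) (hcmono ω hqr), ?_, ?_, fun q => ?_⟩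
    · have := tendsto_atTop_iSup (hcmono ω)
      rw [h1] at this
      exact (ENNReal.tendsto_toReal ENNReal.one_ne_top).comp this
    · have := tendsto_atBot_iInf (hcmono ω)
      rw [h0] at this
      exact (ENNReal.tendsto_toReal ENNReal.zero_ne_top).comp this
    · rw [hM]
      simp only
      rw [← hr q, ENNReal.toReal_iInf fun r => hne _ _]
  set L : Ω → ProbabilityMeasure ℝ := fun ω =>
    ⟨(stieltjesOfMeasurableRat M hMm ω).measure, inferInstance⟩ with hL
  have hLm : Measurable L := (measurable_measure_stieltjesOfMeasurableRat hMm).subtype_mk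
  refine ⟨L, hLm, fun B hB => ?_⟩
  induction B, hB using MeasurableSpace.induction_on_inter
    ((BorelSpace.measurable_eq (α := ℝ)).trans Real.borel_eq_generateFrom_Iic_rat)
    Real.isPiSystem_Iic_rat with
  | empty => simp
  | basic t ht =>
    obtain ⟨q, rfl⟩ : ∃ q : ℚ, t = Set.Iic (q : ℝ) := by simpa [eq_comm] using ht
    filter_upwards [hct _ measurableSet_Iic, hpt] with ω h1 h2
    have : (L ω : Measure ℝ) (Set.Iic (q : ℝ)) = c (Set.Iic (q : ℝ)) ω := by
      change (stieltjesOfMeasurableRat M hMm ω).measure _ = _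
      rw [measure_stieltjesOfMeasurableRat_Iic, stieltjesOfMeasurableRat_eq,
        toRatCDF_of_isRatStieltjesPoint h2, ENNReal.ofReal_toReal (hne _ _)]
    rwa [this]
  | compl t ht ih =>
    filter_upwards [ih] with ω hω
    simp only [prob_compl_eq_one_sub ht]
    exact ENNReal.Tendsto.sub tendsto_const_nhds hω (Or.inl ENNReal.one_ne_top)
  | iUnion f hd hf ih =>
    have hU := MeasurableSet.iUnion hf
    -- Finite unions pass to the limit and give only this inequality. Both sides have mean `ν (⋃ i,
    -- f i)`, so they coincide almost surely.
    have hle : ∀ᵐ ω ∂P, (L ω : Measure ℝ) (⋃ i, f i) ≤ c (⋃ i, f i) ω := by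
      filter_upwards [ae_all_iff.2 ih, hct _ hU] with ω h1 h2
      rw [measure_iUnion hd hf]
      rw [ENNReal.tsum_eq_iSup_sum]
      refine iSup_le fun s => ?_
      refine le_of_tendsto_of_tendsto' (tendsto_finsetSum s fun i _ => h1 i) h2 fun n => ?_
      rw [← measure_biUnion_finset (fun i _ j _ hij => hd hij) fun i _ => hf i]
      exact measure_mono (Set.iUnion₂_subset_iUnion _ _)
    have hLB : ∀ B, MeasurableSet B → Measurable fun ω => (L ω : Measure ℝ) B := fun B hB =>
      (Measure.measurable_coe hB).comp (measurable_subtype_coe.comp hLm)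
    have hLint : ∫⁻ ω, (L ω : Measure ℝ) (⋃ i, f i) ∂P = ν (⋃ i, f i) := by
      simp only [measure_iUnion hd hf]
      rw [lintegral_tsum fun i => (hLB _ (hf i)).aemeasurable]
      exact tsum_congr fun i => hint_lim _ (hf i) _ (ih i)
    have heq := ae_eq_of_ae_le_of_lintegral_le hle (by rw [hLint]; exact measure_ne_top _ _)
      (hcm _ hU).aemeasurable (by rw [hLint, hcint _ hU])
    filter_upwards [heq, hct _ hU] with ω h1 h2
    rwa [h1]

end RealLine

/-- Random probability measures on a standard Borel space with constant mean measure, whose values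
at each measurable set converge almost surely, converge setwise to a random probability measure. -/
theorem exists_measurable_ae_tendsto_apply [StandardBorelSpace S] [IsProbabilityMeasure P]
    {ν : Measure S} [IsProbabilityMeasure ν] {H : ℕ → Ω → ProbabilityMeasure S}
    (hH : ∀ n, Measurable (H n))
    (hmean : ∀ n B, MeasurableSet B → ∫⁻ ω, (H n ω : Measure S) B ∂P = ν B)
    (hconv : ∀ B, MeasurableSet B → ∀ᵐ ω ∂P,
      ∃ c, Tendsto (fun n => (H n ω : Measure S) B) atTop (𝓝 c)) :
    ∃ L : Ω → ProbabilityMeasure S, Measurable L ∧ ∀ B, MeasurableSet B → ∀ᵐ ω ∂P,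
      Tendsto (fun n => (H n ω : Measure S) B) atTop (𝓝 ((L ω : Measure S) B)) := by
  have he := measurableEmbedding_embeddingReal S
  have : Nonempty S := ν.nonempty_of_neZero
  -- `g` is a measurable left inverse of the embedding `e`; it brings the limit found on the line
  -- back to `S`, even if that limit charges points outside the range of `e`.
  obtain ⟨g, hg, hge⟩ := he.exists_measurable_extend measurable_id fun _ => this
  set e := embeddingReal S
  have hgB : ∀ B, e ⁻¹' (g ⁻¹' B) = B := fun B => by
    rw [← Set.preimage_comp, hge, Set.preimage_id]
  have : IsProbabilityMeasure (ν.map e) :=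
    Measure.isProbabilityMeasure_map he.measurable.aemeasurable
  obtain ⟨L, hL, hLt⟩ := exists_measurable_ae_tendsto_apply_real (P := P) (ν := ν.map e)
    (H := fun n ω => (H n ω).map he.measurable.aemeasurable)
    (fun n => measurable_map_probabilityMeasure he.measurable (hH n))
    (fun n B hB => by
      simp only [ProbabilityMeasure.toMeasure_map, Measure.map_apply he.measurable hB]
      exact hmean n _ (he.measurable hB))
    (fun B hB => by
      simp only [ProbabilityMeasure.toMeasure_map, Measure.map_apply he.measurable hB]
      exact hconv _ (he.measurable hB))
  refine ⟨fun ω => (L ω).map hg.aemeasurable, measurable_map_probabilityMeasure hg hL, fun B hB => ?_⟩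
  filter_upwards [hLt _ (hg hB)] with ω hω
  simpa only [ProbabilityMeasure.toMeasure_map, Measure.map_apply he.measurable (hg hB),
    Measure.map_apply hg hB, hgB] using hω

end RandomMeasures

/-! ### Conditional laws and disintegration of joint laws -/

section ConditionalLaws

variable {Ω S T : Type*} [MeasurableSpace Ω] [MeasurableSpace S] [MeasurableSpace T]
  {P : Measure Ω} [IsProbabilityMeasure P] {Z : Ω → T} {Y : Ω → S} {K : Kernel T S}
  [IsMarkovKernel K]

/-- Rectangles determine the joint law, and on a rectangle the identity is the defining property of
conditional expectation on `{Z ∈ s}`. An assertion about one set at a time thus becomes one equality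
of measures, usable with arbitrary integrands. -/
theorem HasCondLaw.map_eq_compProd (hZ : Measurable Z) (hY : Measurable Y)
    (h : HasCondLaw (MeasurableSpace.comap Z inferInstance) Y (fun ω => K (Z ω)) P) :
    P.map (fun ω => (Z ω, Y ω)) = P.map Z ⊗ₘ K := by
  have := Measure.isProbabilityMeasure_map (μ := P) hZ.aemeasurable
  have := Measure.isProbabilityMeasure_map (μ := P) (hZ.prodMk hY).aemeasurable
  refine Measure.ext_prod fun {s t} hs ht => ?_
  rw [Measure.map_apply (hZ.prodMk hY) (hs.prod ht), Measure.compProd_apply_prod hs ht,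
    setLIntegral_map hs (K.measurable_coe ht) hZ, Set.mk_preimage_prod]
  have h1 := setIntegral_condExp (μ := P) hZ.comap_le
    (f := (Y ⁻¹' t).indicator fun _ => (1 : ℝ)) ((integrable_const _).indicator (hY ht))
    (s := Z ⁻¹' s) ⟨s, hs, rfl⟩
  rw [setIntegral_congr_ae (hZ hs) ((h t ht).mono fun ω hω _ => hω),
    integral_indicator_const _ (hY ht), measureReal_restrict_apply (hY ht), smul_eq_mul,
    mul_one] at h1
  simp_rw [measureReal_def] at h1
  rw [integral_toReal (f := fun ω => K (Z ω) t) ((K.measurable_coe ht).comp hZ).aemeasurable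
    (Eventually.of_forall fun ω => measure_lt_top _ _)] at h1
  rw [Set.inter_comm, ← ENNReal.ofReal_toReal (measure_ne_top P _), ← h1, ENNReal.ofReal_toReal]
  refine ne_top_of_le_ne_top ENNReal.one_ne_top ?_
  calc ∫⁻ ω in Z ⁻¹' s, K (Z ω) t ∂P ≤ ∫⁻ _ in Z ⁻¹' s, 1 ∂P := lintegral_mono fun _ => prob_le_one
    _ ≤ 1 := by simpa using prob_le_one

theorem lintegral_comp_eq_of_map_eq_compProd (hZ : Measurable Z) (hY : Measurable Y)
    (h : P.map (fun ω => (Z ω, Y ω)) = P.map Z ⊗ₘ K) {g : T × S → ℝ≥0∞} (hg : Measurable g) :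
    ∫⁻ ω, g (Z ω, Y ω) ∂P = ∫⁻ ω, ∫⁻ y, g (Z ω, y) ∂(K (Z ω)) ∂P := by
  rw [← lintegral_map hg (hZ.prodMk hY), h, Measure.lintegral_compProd hg,
    lintegral_map hg.lintegral_kernel_prod_right' hZ]

/-- Disintegrations into a standard Borel space are almost surely unique, so `K` may replace the
regular conditional distribution. -/
theorem condExp_comp_eq_of_map_eq_compProd [StandardBorelSpace S] [Nonempty S]
    (hZ : Measurable Z) (hY : Measurable Y)
    (h : P.map (fun ω => (Z ω, Y ω)) = P.map Z ⊗ₘ K) {g : S → ℝ} (hg : Measurable g)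
    {C : ℝ} (hC : ∀ s, |g s| ≤ C) :
    P[fun ω => g (Y ω) | MeasurableSpace.comap Z inferInstance]
      =ᵐ[P] fun ω => ∫ y, g y ∂(K (Z ω)) := by
  have h1 := condExp_ae_eq_integral_condDistrib (μ := P) hZ hY.aemeasurable hg.stronglyMeasurable
    (Integrable.of_bound (hg.comp hY).aestronglyMeasurable C
      (Eventually.of_forall fun ω => hC (Y ω)))
  have h2 := ae_of_ae_map hZ.aemeasurable
    (condDistrib_ae_eq_of_measure_eq_compProd Z hY.aemeasurable h)
  filter_upwards [h1, h2] with ω h1 h2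
  rw [h1, h2]

theorem hasCondLaw_of_map_eq_compProd [StandardBorelSpace S] [Nonempty S]
    (hZ : Measurable Z) (hY : Measurable Y)
    (h : P.map (fun ω => (Z ω, Y ω)) = P.map Z ⊗ₘ K) :
    HasCondLaw (MeasurableSpace.comap Z inferInstance) Y (fun ω => K (Z ω)) P := by
  intro B hB
  have h1 := condDistrib_ae_eq_condExp (μ := P) hZ hY hB
  have h2 := ae_of_ae_map hZ.aemeasurable
    (condDistrib_ae_eq_of_measure_eq_compProd Z hY.aemeasurable h)
  filter_upwards [h1, h2] with ω h1 h2
  rw [← h1, h2]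

/-- Two functions of `Z` and of an arbitrary variable that have the same integrals against all
nonnegative functions of `Z` agree in conditional expectation. -/
theorem condExp_toReal_eq_of_forall_lintegral_eq (hZ : Measurable Z) {U : Ω → ℝ≥0∞}
    {V : T → ℝ≥0∞} (hU : Measurable U) (hU1 : ∀ ω, U ω ≤ 1) (hV : Measurable V)
    (hV1 : ∀ z, V z ≤ 1)
    (h : ∀ g : T → ℝ≥0∞, Measurable g → ∫⁻ ω, g (Z ω) * U ω ∂P = ∫⁻ ω, g (Z ω) * V (Z ω) ∂P) :
    P[fun ω => (U ω).toReal | MeasurableSpace.comap Z inferInstance]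
      =ᵐ[P] fun ω => (V (Z ω)).toReal := by
  have hb : ∀ {W : Ω → ℝ≥0∞}, Measurable W → (∀ ω, W ω ≤ 1) →
      Integrable (fun ω => (W ω).toReal) P := fun hW hW1 =>
    Integrable.of_bound hW.ennreal_toReal.aestronglyMeasurable 1
      (Eventually.of_forall fun ω => by
        rw [Real.norm_of_nonneg ENNReal.toReal_nonneg]
        exact ENNReal.toReal_le_of_le_ofReal zero_le_one (by simpa using hW1 ω))
  refine (ae_eq_condExp_of_forall_setIntegral_eq hZ.comap_le (hb hU hU1)
    (fun _ _ _ => (hb (hV.comp hZ) fun ω => hV1 _).integrableOn) ?_ ?_).symm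
  · rintro _ ⟨s, hs, rfl⟩ -
    simp only [Function.comp_apply]
    rw [integral_toReal (f := fun ω => V (Z ω)) (hV.comp hZ).aemeasurable
        (Eventually.of_forall fun ω => (hV1 _).trans_lt ENNReal.one_lt_top),
      integral_toReal hU.aemeasurable
        (Eventually.of_forall fun ω => (hU1 _).trans_lt ENNReal.one_lt_top)]
    have h1 := h (s.indicator 1) (measurable_one.indicator hs)
    have hi : ∀ W : Ω → ℝ≥0∞, ∫⁻ ω, s.indicator 1 (Z ω) * W ω ∂P = ∫⁻ ω in Z ⁻¹' s, W ω ∂P := by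
      intro W
      rw [← lintegral_indicator (hZ hs)]
      refine lintegral_congr fun ω => ?_
      by_cases hω : Z ω ∈ s <;> simp [hω]
    rw [hi, hi] at h1
    rw [h1]
  · exact ((hV.ennreal_toReal.comp (comap_measurable Z)).stronglyMeasurable).aestronglyMeasurable

end ConditionalLaws

/-! ### The natural filtration of the observations -/

section Past

variable {Ω S : Type*} [mΩ : MeasurableSpace Ω] [MeasurableSpace S] {X : ℕ → Ω → S}

theorem measurable_past (hX : ∀ n, Measurable (X n)) (n : ℕ) :
    Measurable fun ω (i : Fin n) => X i ω :=
  measurable_pi_iff.2 fun i => hX i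

theorem pastSigma_mono (X : ℕ → Ω → S) : Monotone (pastSigma X) := by
  intro n m hnm
  have h : (fun ω (i : Fin n) => X i ω)
      = (fun (z : Fin m → S) (i : Fin n) => z (Fin.castLE hnm i)) ∘ fun ω (i : Fin m) => X i ω := rfl
  rw [pastSigma, h, ← MeasurableSpace.comap_comp]
  exact MeasurableSpace.comap_mono
    (measurable_pi_iff.2 fun i => measurable_pi_apply _).comap_le

/-- The natural filtration, in which time `n` knows `X 0, …, X (n - 1)`. -/
noncomputable def pastFiltration (hX : ∀ n, Measurable (X n)) : Filtration ℕ mΩ where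
  seq := pastSigma X
  mono' := pastSigma_mono X
  le' n := (measurable_past hX n).comap_le

theorem measurable_pastSigma_succ (X : ℕ → Ω → S) (n : ℕ) : Measurable[pastSigma X (n + 1)] (X n) :=
  (measurable_pi_apply (Fin.last n)).comp
    (comap_measurable fun ω (i : Fin (n + 1)) => X i ω)

end Past

/-! ### Measurability and mean preservation of Newton's recursion -/

section NewtonKernels

variable {𝕏 Θ : Type*} [MeasurableSpace 𝕏] [MeasurableSpace Θ] {μ : Measure 𝕏}
  {f : 𝕏 → Θ → ℝ≥0}

theorem measurable_coe_apply {B : Set Θ} (hB : MeasurableSet B) :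
    Measurable fun G : ProbabilityMeasure Θ => (G : Measure Θ) B :=
  (Measure.measurable_coe hB).comp measurable_subtype_coe

/-- The identity, as a Markov kernel from probability measures. -/
noncomputable def coeKernel (A Θ : Type*) [MeasurableSpace A] [MeasurableSpace Θ] :
    Kernel (ProbabilityMeasure Θ × A) Θ where
  toFun p := p.1
  measurable' := measurable_subtype_coe.comp measurable_fst

instance (A Θ : Type*) [MeasurableSpace A] [MeasurableSpace Θ] :
    IsMarkovKernel (coeKernel A Θ) :=
  ⟨fun p => inferInstanceAs (IsProbabilityMeasure (p.1 : Measure Θ))⟩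

theorem measurable_setLIntegral_coe (hf : Measurable (Function.uncurry f)) {B : Set Θ}
    (hB : MeasurableSet B) :
    Measurable fun p : ProbabilityMeasure Θ × 𝕏 => ∫⁻ t in B, f p.2 t ∂(p.1 : Measure Θ) :=
  Measurable.setLIntegral_kernel_prod_right (κ := coeKernel 𝕏 Θ)
    (f := fun (p : ProbabilityMeasure Θ × 𝕏) t => (f p.2 t : ℝ≥0∞))
    (hf.comp ((measurable_snd.comp measurable_fst).prodMk measurable_snd)).coe_nnreal_ennreal hB

theorem measurable_mixDensity (hf : Measurable (Function.uncurry f)) :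
    Measurable fun p : ProbabilityMeasure Θ × 𝕏 => mixDensity f p.1 p.2 := by
  simpa [mixDensity] using measurable_setLIntegral_coe hf MeasurableSet.univ

theorem toMeasure_posterior {G : ProbabilityMeasure Θ} {x : 𝕏}
    (h : mixDensity f G x ≠ 0 ∧ mixDensity f G x ≠ ∞) :
    (posterior f G x : Measure Θ)
      = (mixDensity f G x)⁻¹ • (G : Measure Θ).withDensity (fun t => f x t) :=
  congrArg Subtype.val (dif_pos h)

theorem posterior_eq_self {G : ProbabilityMeasure Θ} {x : 𝕏}
    (h : ¬(mixDensity f G x ≠ 0 ∧ mixDensity f G x ≠ ∞)) : posterior f G x = G :=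
  dif_neg h

theorem measurable_posterior (hf : Measurable (Function.uncurry f)) :
    Measurable fun p : ProbabilityMeasure Θ × 𝕏 => posterior f p.1 p.2 := by
  have hm := measurable_mixDensity hf
  refine Measurable.subtype_mk (p := fun m : Measure Θ => IsProbabilityMeasure m)
    (f := fun p : ProbabilityMeasure Θ × 𝕏 => (posterior f p.1 p.2 : Measure Θ))
    (h := fun p => (posterior f p.1 p.2).2) ?_
  refine Measure.measurable_of_measurable_coe _ fun B hB => ?_
  classical
  have heq : (fun p : ProbabilityMeasure Θ × 𝕏 => (posterior f p.1 p.2 : Measure Θ) B)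
      = fun p => if p ∈ {p : ProbabilityMeasure Θ × 𝕏 |
          mixDensity f p.1 p.2 ≠ 0 ∧ mixDensity f p.1 p.2 ≠ ∞}
        then (mixDensity f p.1 p.2)⁻¹ * ∫⁻ t in B, f p.2 t ∂(p.1 : Measure Θ)
        else (p.1 : Measure Θ) B := by
    ext p
    by_cases h : mixDensity f p.1 p.2 ≠ 0 ∧ mixDensity f p.1 p.2 ≠ ∞
    · rw [if_pos (by exact h), toMeasure_posterior h]
      simp [withDensity_apply _ hB]
    · rw [if_neg (by exact h), posterior_eq_self h]
  rw [heq]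
  refine Measurable.ite ?_ (hm.inv.mul (measurable_setLIntegral_coe hf hB))
    ((measurable_coe_apply hB).comp measurable_fst)
  exact (hm (measurableSet_singleton 0).compl).inter (hm (measurableSet_singleton ∞).compl)

theorem measurable_newtonStep (hf : Measurable (Function.uncurry f)) (a : Set.Ioo (0 : ℝ) 1) :
    Measurable fun p : ProbabilityMeasure Θ × 𝕏 => newtonStep f a p.1 p.2 := by
  refine Measurable.subtype_mk (p := fun m : Measure Θ => IsProbabilityMeasure m)
    (f := fun p : ProbabilityMeasure Θ × 𝕏 => (newtonStep f a p.1 p.2 : Measure Θ))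
    (h := fun p => (newtonStep f a p.1 p.2).2) ?_
  refine Measure.measurable_of_measurable_coe _ fun B hB => ?_
  exact (((measurable_coe_apply hB).comp measurable_fst).const_mul _).add
    (((measurable_coe_apply hB).comp (measurable_posterior hf)).const_mul _)

/-- Newton's recursion as a function of a finite sequence of observations. -/
noncomputable def newtonPast (f : 𝕏 → Θ → ℝ≥0) (α : ℕ → Set.Ioo (0 : ℝ) 1)
    (G₀ : ProbabilityMeasure Θ) : (n : ℕ) → (Fin n → 𝕏) → ProbabilityMeasure Θ
  | 0, _ => G₀
  | n + 1, z => newtonStep f (α n) (newtonPast f α G₀ n fun i => z i.castSucc) (z (Fin.last n))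

theorem newtonSeq_eq_newtonPast (f : 𝕏 → Θ → ℝ≥0) (α : ℕ → Set.Ioo (0 : ℝ) 1)
    (G₀ : ProbabilityMeasure Θ) (x : ℕ → 𝕏) (n : ℕ) :
    newtonSeq f α G₀ x n = newtonPast f α G₀ n fun i => x i := by
  induction n with
  | zero => rfl
  | succ n ih => simp only [newtonSeq, newtonPast, ih]; rfl

theorem measurable_newtonPast (hf : Measurable (Function.uncurry f)) (α : ℕ → Set.Ioo (0 : ℝ) 1)
    (G₀ : ProbabilityMeasure Θ) (n : ℕ) : Measurable (newtonPast f α G₀ n) := by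
  induction n with
  | zero => exact measurable_const
  | succ n ih =>
    exact (measurable_newtonStep hf (α n)).comp
      ((ih.comp (measurable_pi_iff.2 fun i => measurable_pi_apply _)).prodMk
        (measurable_pi_apply _))

/-- The conditional law of the parameter, as a kernel from the past observations. -/
noncomputable def paramKernel (hf : Measurable (Function.uncurry f)) (α : ℕ → Set.Ioo (0 : ℝ) 1)
    (G₀ : ProbabilityMeasure Θ) (n : ℕ) : Kernel (Fin n → 𝕏) Θ where
  toFun z := newtonPast f α G₀ n z
  measurable' := measurable_subtype_coe.comp (measurable_newtonPast hf α G₀ n)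

instance (hf : Measurable (Function.uncurry f)) (α : ℕ → Set.Ioo (0 : ℝ) 1)
    (G₀ : ProbabilityMeasure Θ) (n : ℕ) : IsMarkovKernel (paramKernel hf α G₀ n) :=
  ⟨fun z => inferInstanceAs (IsProbabilityMeasure (newtonPast f α G₀ n z : Measure Θ))⟩

variable [SigmaFinite μ]

theorem IsMixtureKernel.measurable_swap (hf : IsMixtureKernel f μ) :
    Measurable (Function.uncurry fun (t : Θ) (x : 𝕏) => (f x t : ℝ≥0∞)) :=
  (hf.measurable.comp _root_.measurable_swap).coe_nnreal_ennreal

theorem IsMixtureKernel.measurable_left (hf : IsMixtureKernel f μ) (t : Θ) :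
    Measurable fun x => (f x t : ℝ≥0∞) :=
  hf.measurable_swap.comp measurable_prodMk_left

/-- The law of an observation given the parameter, as a kernel. -/
noncomputable def obsKernel (f : 𝕏 → Θ → ℝ≥0) (μ : Measure 𝕏) [SigmaFinite μ] : Kernel Θ 𝕏 :=
  Kernel.withDensity (Kernel.const Θ μ) fun t x => f x t

theorem obsKernel_apply (hf : IsMixtureKernel f μ) (t : Θ) :
    obsKernel f μ t = μ.withDensity fun x => f x t := by
  rw [obsKernel, Kernel.withDensity_apply _ hf.measurable_swap, Kernel.const_apply]

theorem isMarkovKernel_obsKernel (hf : IsMixtureKernel f μ) : IsMarkovKernel (obsKernel f μ) :=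
  ⟨fun t => ⟨by
    rw [obsKernel_apply hf, withDensity_apply _ MeasurableSet.univ, Measure.restrict_univ,
      hf.lintegral_eq_one]⟩⟩

theorem bind_obsKernel (hf : IsMixtureKernel f μ) (G : ProbabilityMeasure Θ) :
    (G : Measure Θ).bind (obsKernel f μ) = μ.withDensity (mixDensity f G) := by
  ext B hB
  rw [Measure.bind_apply hB (obsKernel f μ).measurable.aemeasurable, withDensity_apply _ hB]
  simp only [obsKernel_apply hf, withDensity_apply _ hB, mixDensity]
  exact lintegral_lintegral_swap (hf.measurable_swap.aemeasurable)

theorem isProbabilityMeasure_withDensity_mixDensity (hf : IsMixtureKernel f μ)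
    (G : ProbabilityMeasure Θ) : IsProbabilityMeasure (μ.withDensity (mixDensity f G)) := by
  have := isMarkovKernel_obsKernel hf
  rw [← bind_obsKernel hf]
  infer_instance

theorem lintegral_mixDensity (hf : IsMixtureKernel f μ) (G : ProbabilityMeasure Θ) :
    ∫⁻ x, mixDensity f G x ∂μ = 1 := by
  have := (isProbabilityMeasure_withDensity_mixDensity hf G).measure_univ
  rwa [withDensity_apply _ MeasurableSet.univ, Measure.restrict_univ] at this

theorem measurable_mixDensity_right (hf : IsMixtureKernel f μ) (G : ProbabilityMeasure Θ) :
    Measurable (mixDensity f G) :=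
  (measurable_mixDensity hf.measurable).comp measurable_prodMk_left

/-- The factor `f_G(x)` cancels the normalisation of the posterior, leaving `∫ f(x ∣ t) φ(t) dG(t)`;
Tonelli and `∫ f(x ∣ t) dμ(x) = 1` finish. This is the identity behind all the martingales. -/
theorem lintegral_lintegral_posterior (hf : IsMixtureKernel f μ) (G : ProbabilityMeasure Θ)
    {φ : Θ → ℝ≥0∞} (hφ : Measurable φ) :
    ∫⁻ x, ∫⁻ t, φ t ∂(posterior f G x : Measure Θ) ∂(μ.withDensity (mixDensity f G))
      = ∫⁻ t, φ t ∂(G : Measure Θ) := by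
  have hm := measurable_mixDensity_right hf G
  have hfx : ∀ x, Measurable fun t => (f x t : ℝ≥0∞) := fun x =>
    (hf.measurable.comp measurable_prodMk_left).coe_nnreal_ennreal
  have hpost : Measurable fun x => ∫⁻ t, φ t ∂(posterior f G x : Measure Θ) :=
    (Measure.measurable_lintegral hφ).comp (measurable_subtype_coe.comp
      ((measurable_posterior hf.measurable).comp measurable_prodMk_left))
  rw [lintegral_withDensity_eq_lintegral_mul _ hm hpost]
  have hfin : ∀ᵐ x ∂μ, mixDensity f G x < ∞ :=
    ae_lt_top hm (by rw [lintegral_mixDensity hf]; exact ENNReal.one_ne_top)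
  have hae : ∀ᵐ x ∂μ, (mixDensity f G * fun x => ∫⁻ t, φ t ∂(posterior f G x : Measure Θ)) x
      = ∫⁻ t, f x t * φ t ∂(G : Measure Θ) := by
    filter_upwards [hfin] with x hx
    rw [Pi.mul_apply]
    -- The default value of the posterior is harmless here: where `f_G(x) = 0`, also `f(x ∣ t) = 0`
    -- for `G`-almost every `t`, so both sides vanish.
    by_cases h0 : mixDensity f G x = 0
    · rw [h0, zero_mul]
      have h1 := (lintegral_eq_zero_iff (hfx x)).1 h0
      refine (lintegral_eq_zero_of_ae_eq_zero ?_).symm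
      filter_upwards [h1] with t ht
      rw [ht]; simp
    · have h : mixDensity f G x ≠ 0 ∧ mixDensity f G x ≠ ∞ := ⟨h0, hx.ne⟩
      rw [toMeasure_posterior h, lintegral_smul_measure, smul_eq_mul, ← mul_assoc, ENNReal.mul_inv_cancel h.1 h.2, one_mul,
        lintegral_withDensity_eq_lintegral_mul _ (hfx x) hφ]
      rfl
  rw [lintegral_congr_ae hae, lintegral_lintegral_swap]
  · refine lintegral_congr fun t => ?_
    rw [lintegral_mul_const _ (hf.measurable_left t), hf.lintegral_eq_one, one_mul]
  · exact (hf.measurable.coe_nnreal_ennreal.mul (hφ.comp measurable_snd)).aemeasurable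

theorem lintegral_newtonStep (a : Set.Ioo (0 : ℝ) 1) (G : ProbabilityMeasure Θ) (x : 𝕏)
    (φ : Θ → ℝ≥0∞) :
    ∫⁻ t, φ t ∂(newtonStep f a G x : Measure Θ)
      = ENNReal.ofReal (1 - a) * ∫⁻ t, φ t ∂(G : Measure Θ)
        + ENNReal.ofReal a * ∫⁻ t, φ t ∂(posterior f G x : Measure Θ) := by
  simp only [newtonStep, ProbabilityMeasure.coe_mk]
  rw [lintegral_add_measure, lintegral_smul_measure, lintegral_smul_measure, smul_eq_mul,
    smul_eq_mul]

/-- Newton's recursion preserves the mean when the next observation is drawn from the current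
predictive law. -/
theorem lintegral_lintegral_newtonStep (hf : IsMixtureKernel f μ) (a : Set.Ioo (0 : ℝ) 1)
    (G : ProbabilityMeasure Θ) {φ : Θ → ℝ≥0∞} (hφ : Measurable φ) :
    ∫⁻ x, ∫⁻ t, φ t ∂(newtonStep f a G x : Measure Θ) ∂(μ.withDensity (mixDensity f G))
      = ∫⁻ t, φ t ∂(G : Measure Θ) := by
  have := isProbabilityMeasure_withDensity_mixDensity hf G
  have hpost : Measurable fun x => ∫⁻ t, φ t ∂(posterior f G x : Measure Θ) :=
    (Measure.measurable_lintegral hφ).comp (measurable_subtype_coe.comp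
      ((measurable_posterior hf.measurable).comp measurable_prodMk_left))
  simp only [lintegral_newtonStep]
  rw [lintegral_add_left measurable_const, lintegral_const, measure_univ, mul_one,
    lintegral_const_mul _ hpost, lintegral_lintegral_posterior hf G hφ, ← add_mul,
    ← ENNReal.ofReal_add (sub_nonneg.2 a.2.2.le) a.2.1.le]
  simp

end NewtonKernels

/-! ### The martingale property of the recursive estimates -/

section NewtonProcess

variable {Ω 𝕏 Θ : Type*} [MeasurableSpace Ω] [MeasurableSpace 𝕏] [MeasurableSpace Θ]
  {P : Measure Ω} [IsProbabilityMeasure P] {μ : Measure 𝕏} [SigmaFinite μ] {f : 𝕏 → Θ → ℝ≥0}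
  {α : ℕ → Set.Ioo (0 : ℝ) 1} {G₀ : ProbabilityMeasure Θ} {X : ℕ → Ω → 𝕏} {θ : ℕ → Ω → Θ}

theorem measurable_newtonSeq (hf : Measurable (Function.uncurry f)) (hX : ∀ n, Measurable (X n))
    (n : ℕ) : Measurable fun ω => newtonSeq f α G₀ (fun i => X i ω) n := by
  simp only [newtonSeq_eq_newtonPast]
  exact (measurable_newtonPast hf α G₀ n).comp (measurable_past hX n)

theorem obsKernel_comp_paramKernel_apply (hf : IsMixtureKernel f μ) (n : ℕ) (ω : Ω) :
    (obsKernel f μ ∘ₖ paramKernel hf.measurable α G₀ n) (fun i => X i ω)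
      = μ.withDensity (mixDensity f (newtonSeq f α G₀ (fun i => X i ω) n)) := by
  rw [Kernel.comp_apply, newtonSeq_eq_newtonPast, ← bind_obsKernel hf]
  rfl

/-- The joint law of the past and the next observation. -/
theorem IsNewtonModel.map_past_obs (hf : IsMixtureKernel f μ)
    (hP : IsNewtonModel P μ f α G₀ X θ) (n : ℕ) :
    P.map (fun ω => ((fun i : Fin n => X i ω), X n ω))
      = P.map (fun ω (i : Fin n) => X i ω)
        ⊗ₘ (obsKernel f μ ∘ₖ paramKernel hf.measurable α G₀ n) := by
  have := isMarkovKernel_obsKernel hf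
  have hZ := measurable_past hP.measurable_obs n
  have hθ := hP.measurable_param n
  have hX := hP.measurable_obs n
  have hpar : P.map (fun ω => ((fun i : Fin n => X i ω), θ n ω))
      = P.map (fun ω (i : Fin n) => X i ω) ⊗ₘ paramKernel hf.measurable α G₀ n := by
    refine HasCondLaw.map_eq_compProd hZ hθ ?_
    have := hP.param_law n
    simp only [newtonSeq_eq_newtonPast] at this
    exact this
  -- The kernel ignores the past: given the parameter, past observations carry no further
  -- information on the next one.
  have hobs : P.map (fun ω => (((fun i : Fin n => X i ω), θ n ω), X n ω))
      = P.map (fun ω => ((fun i : Fin n => X i ω), θ n ω))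
        ⊗ₘ (Kernel.prodMkLeft (Fin n → 𝕏) (obsKernel f μ)) := by
    refine HasCondLaw.map_eq_compProd (hZ.prodMk hθ) hX ?_
    have h1 := hP.obs_law n
    have hσ : pastSigma X n ⊔ MeasurableSpace.comap (θ n) inferInstance
        = MeasurableSpace.comap (fun ω => ((fun i : Fin n => X i ω), θ n ω)) inferInstance :=
      (MeasurableSpace.comap_prodMk _ _).symm
    rw [hσ] at h1
    simpa only [Kernel.prodMkLeft_apply, obsKernel_apply hf] using h1
  refine Measure.ext_of_lintegral _ fun g hg => ?_
  have hg' : Measurable fun p : ((Fin n → 𝕏) × Θ) × 𝕏 => g (p.1.1, p.2) :=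
    hg.comp ((measurable_fst.comp measurable_fst).prodMk measurable_snd)
  rw [lintegral_map hg (hZ.prodMk hX), Measure.lintegral_compProd hg,
    lintegral_map hg.lintegral_kernel_prod_right' hZ,
    lintegral_comp_eq_of_map_eq_compProd (hZ.prodMk hθ) hX hobs hg']
  have h2 := lintegral_comp_eq_of_map_eq_compProd hZ hθ hpar
    (g := fun p => ∫⁻ x, g (p.1, x) ∂(obsKernel f μ p.2))
    (hg'.lintegral_kernel_prod_right' (κ := Kernel.prodMkLeft (Fin n → 𝕏) (obsKernel f μ)))
  refine h2.trans (lintegral_congr fun ω => ?_)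
  exact (Kernel.lintegral_comp _ _ _ (hg.comp measurable_prodMk_left)).symm

/-- Under Newton's model, integrals against the recursive estimates form martingales. -/
theorem IsNewtonModel.condExp_lintegral_newtonSeq (hf : IsMixtureKernel f μ)
    (hP : IsNewtonModel P μ f α G₀ X θ) {φ : Θ → ℝ≥0∞} (hφ : Measurable φ) (hφ1 : ∀ t, φ t ≤ 1)
    (n : ℕ) :
    P[fun ω => (∫⁻ t, φ t ∂(newtonSeq f α G₀ (fun i => X i ω) (n + 1) : Measure Θ)).toReal |
        pastSigma X n]
      =ᵐ[P] fun ω => (∫⁻ t, φ t ∂(newtonSeq f α G₀ (fun i => X i ω) n : Measure Θ)).toReal := by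
  have := isMarkovKernel_obsKernel hf
  have hZ := measurable_past hP.measurable_obs n
  -- Keeping the integral functional abstract lets the recursion be unfolded without unfolding the
  -- integral.
  obtain ⟨Φ, hΦ⟩ : ∃ Φ : ProbabilityMeasure Θ → ℝ≥0∞, ∀ G, Φ G = ∫⁻ t, φ t ∂(G : Measure Θ) :=
    ⟨_, fun _ => rfl⟩
  have hle : ∀ G, Φ G ≤ 1 := fun G => by
    rw [hΦ]; exact (lintegral_mono hφ1).trans (by simp)
  have hmΦ : Measurable Φ := by
    rw [funext hΦ]; exact (Measure.measurable_lintegral hφ).comp measurable_subtype_coe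
  have hΓ := measurable_newtonPast hf.measurable α G₀ n
  have hstep : Measurable fun p : (Fin n → 𝕏) × 𝕏 =>
      Φ (newtonStep f (α n) (newtonPast f α G₀ n p.1) p.2) :=
    hmΦ.comp ((measurable_newtonStep hf.measurable (α n)).comp
      ((hΓ.comp measurable_fst).prodMk measurable_snd))
  have hs : ∀ G, Measurable fun x => Φ (newtonStep f (α n) G x) := fun G =>
    hmΦ.comp ((measurable_newtonStep hf.measurable (α n)).comp measurable_prodMk_left)
  have hU := hmΦ.comp (measurable_newtonSeq (α := α) (G₀ := G₀) hf.measurable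
    hP.measurable_obs (n + 1))
  -- Against a function of the past, the next observation is integrated out under its predictive
  -- law, where the Newton step preserves the mean.
  have key : ∀ g : (Fin n → 𝕏) → ℝ≥0∞, Measurable g →
      ∫⁻ ω, g (fun i => X i ω) * Φ (newtonSeq f α G₀ (fun i => X i ω) (n + 1)) ∂P
        = ∫⁻ ω, g (fun i => X i ω) * Φ (newtonPast f α G₀ n fun i => X i ω) ∂P := by
    intro g hg
    have h1 := lintegral_comp_eq_of_map_eq_compProd hZ (hP.measurable_obs n)
      (hP.map_past_obs hf n)
      (g := fun p => g p.1 * Φ (newtonStep f (α n) (newtonPast f α G₀ n p.1) p.2))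
      ((hg.comp measurable_fst).mul hstep)
    simp only [newtonSeq, newtonSeq_eq_newtonPast]
    refine h1.trans (lintegral_congr fun ω => ?_)
    dsimp only
    rw [lintegral_const_mul _ (hs _), obsKernel_comp_paramKernel_apply hf, newtonSeq_eq_newtonPast]
    simp only [hΦ]
    rw [lintegral_lintegral_newtonStep hf _ _ hφ]
  have h := condExp_toReal_eq_of_forall_lintegral_eq hZ hU (fun ω => hle _) (hmΦ.comp hΓ)
    (fun z => hle _) key
  simp only [Function.comp_apply] at h
  simp only [← hΦ, newtonSeq_eq_newtonPast f α G₀ _ n]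
  exact h

theorem IsNewtonModel.martingale_lintegral_newtonSeq (hf : IsMixtureKernel f μ)
    (hP : IsNewtonModel P μ f α G₀ X θ) {φ : Θ → ℝ≥0∞} (hφ : Measurable φ)
    (hφ1 : ∀ t, φ t ≤ 1) :
    Martingale
      (fun n ω => (∫⁻ t, φ t ∂(newtonSeq f α G₀ (fun i => X i ω) n : Measure Θ)).toReal)
      (pastFiltration hP.measurable_obs) P := by
  have hmφ : Measurable fun G : ProbabilityMeasure Θ =>
      (∫⁻ t, φ t ∂(G : Measure Θ)).toReal :=
    ((Measure.measurable_lintegral hφ).comp measurable_subtype_coe).ennreal_toReal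
  refine martingale_nat (fun n => ?_) (fun n => ?_) fun n => ?_
  · have h := (hmφ.comp (measurable_newtonPast hf.measurable α G₀ n)).comp
      (comap_measurable fun ω (i : Fin n) => X i ω)
    simp only [newtonSeq_eq_newtonPast]
    exact Measurable.stronglyMeasurable h
  · refine Integrable.of_bound (hmφ.comp
      (measurable_newtonSeq hf.measurable hP.measurable_obs n)).aestronglyMeasurable 1
      (Eventually.of_forall fun ω => ?_)
    rw [Real.norm_of_nonneg ENNReal.toReal_nonneg]
    refine ENNReal.toReal_le_of_le_ofReal zero_le_one ?_
    exact (lintegral_mono hφ1).trans (by simp)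
  · exact (hP.condExp_lintegral_newtonSeq hf hφ hφ1 n).symm

end NewtonProcess

/-! ### A strong law for bounded martingale differences -/

section StrongLaw

/-- Kronecker's lemma for the weights `1, 2, 3, …`. -/
theorem tendsto_inv_mul_sum_of_tendsto_sum_div {d : ℕ → ℝ} {c : ℝ}
    (h : Tendsto (fun n => ∑ i ∈ Finset.range n, d i / (i + 1)) atTop (𝓝 c)) :
    Tendsto (fun n : ℕ => (n : ℝ)⁻¹ * ∑ i ∈ Finset.range n, d i) atTop (𝓝 0) := by
  set s : ℕ → ℝ := fun n => ∑ i ∈ Finset.range n, d i / (i + 1) with hs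
  -- Summation by parts; after division by `n` the two terms both tend to `c`, the second as a
  -- Cesàro mean.
  have hsum : ∀ n : ℕ, ∑ i ∈ Finset.range n, d i = n * s n - ∑ i ∈ Finset.range n, s i := by
    intro n
    induction n with
    | zero => simp
    | succ n ih =>
      have h1 : (n : ℝ) + 1 ≠ 0 := by positivity
      have h2 : s (n + 1) = s n + d n / (n + 1) := Finset.sum_range_succ _ _
      rw [Finset.sum_range_succ, ih, Finset.sum_range_succ, h2]
      push_cast
      field_simp
      ring
  have h1 := h.sub h.cesaro
  rw [sub_self] at h1
  refine h1.congr' ?_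
  filter_upwards [eventually_gt_atTop 0] with n hn
  have hn' : (n : ℝ) ≠ 0 := by positivity
  rw [hsum]
  field_simp

variable {Ω : Type*} {mΩ : MeasurableSpace Ω} {P : Measure Ω} [IsProbabilityMeasure P]

theorem integral_mul_condExp_of_bounded {m : MeasurableSpace Ω} (hm : m ≤ mΩ) {V g : Ω → ℝ}
    (hV : StronglyMeasurable[m] V) {C : ℝ} (hVC : ∀ᵐ ω ∂P, |V ω| ≤ C) (hg : Integrable g P) :
    ∫ ω, V ω * (P[g | m]) ω ∂P = ∫ ω, V ω * g ω ∂P := by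
  have hVg : Integrable (V * g) P := hg.bdd_mul (hV.mono hm).aestronglyMeasurable hVC
  rw [← integral_condExp hm (f := fun ω => V ω * g ω)]
  exact integral_congr_ae (condExp_mul_of_stronglyMeasurable_left hV hVg hg).symm

/-- Strong law of large numbers for bounded martingale differences. -/
theorem ae_tendsto_inv_mul_sum_martingaleDifference {𝒢 : Filtration ℕ mΩ} {D : ℕ → Ω → ℝ}
    (hD : ∀ n, StronglyMeasurable[𝒢 (n + 1)] (D n)) {C : ℝ}
    (hC : ∀ n, ∀ᵐ ω ∂P, |D n ω| ≤ C) (h0 : ∀ n, P[D n | 𝒢 n] =ᵐ[P] 0) :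
    ∀ᵐ ω ∂P, Tendsto (fun n : ℕ => (n : ℝ)⁻¹ * ∑ i ∈ Finset.range n, D i ω) atTop (𝓝 0) := by
  have hDm : ∀ n, AEStronglyMeasurable (D n) P := fun n =>
    ((hD n).mono (𝒢.le _)).aestronglyMeasurable
  have hDi : ∀ n, Integrable (D n) P := fun n => Integrable.of_bound (hDm n) C (hC n)
  set M : ℕ → Ω → ℝ := fun n ω => ∑ i ∈ Finset.range n, D i ω / (i + 1) with hM
  have hMsucc : ∀ n ω, M (n + 1) ω = M n ω + D n ω / (n + 1) := fun n ω =>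
    Finset.sum_range_succ _ _
  have hMad : StronglyAdapted 𝒢 M := fun n =>
    Finset.stronglyMeasurable_fun_sum _ fun i hi =>
      (((hD i).mono (𝒢.mono (Finset.mem_range.1 hi))).measurable.div_const _).stronglyMeasurable
  have hMb : ∀ n : ℕ, ∀ᵐ ω ∂P, |M n ω| ≤ n * C := by
    intro n
    filter_upwards [ae_all_iff.2 hC] with ω hω
    refine (Finset.abs_sum_le_sum_abs _ _).trans ?_
    refine (Finset.sum_le_sum (g := fun _ => C) fun i _ => ?_).trans (by simp)
    rw [abs_div, abs_of_pos (by positivity : (0 : ℝ) < i + 1)]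
    exact (div_le_self (abs_nonneg _) (by simp)).trans (hω i)
  have hMm : ∀ n, AEStronglyMeasurable (M n) P := fun n =>
    ((hMad n).mono (𝒢.le _)).aestronglyMeasurable
  have hMi : ∀ n, Integrable (M n) P := fun n => Integrable.of_bound (hMm n) _ (hMb n)
  have hmart : Martingale M 𝒢 P := by
    refine martingale_of_condExp_sub_eq_zero_nat hMad hMi fun n => ?_
    have : M (n + 1) - M n = ((n : ℝ) + 1)⁻¹ • D n := by
      ext ω
      simp only [Pi.sub_apply, hMsucc, Pi.smul_apply, smul_eq_mul]
      ring
    rw [this]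
    filter_upwards [condExp_smul (μ := P) ((n : ℝ) + 1)⁻¹ (D n) (𝒢 n), h0 n] with ω h1 h2
    rw [h1, Pi.smul_apply, h2]
    simp
  -- Increments are orthogonal to the past, so second moments add up and are controlled by `C ^ 2 *
  -- ∑ 1 / (i + 1) ^ 2`.
  have horth : ∀ n, ∫ ω, M n ω * D n ω ∂P = 0 := by
    intro n
    rw [← integral_mul_condExp_of_bounded (𝒢.le n) (hMad n) (hMb n) (hDi n)]
    refine integral_eq_zero_of_ae ?_
    filter_upwards [h0 n] with ω hω
    rw [hω]; simp
  have hM2i : ∀ n, Integrable (fun ω => M n ω * M n ω) P := fun n =>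
    (hMi n).bdd_mul (hMm n) (hMb n)
  have hMDi : ∀ n, Integrable (fun ω => M n ω * D n ω) P := fun n =>
    (hDi n).bdd_mul (hMm n) (hMb n)
  have hD2i : ∀ n, Integrable (fun ω => D n ω * D n ω) P := fun n =>
    (hDi n).bdd_mul (hDm n) (hC n)
  have hvar : ∀ n, ∫ ω, M n ω * M n ω ∂P
      ≤ ∑ i ∈ Finset.range n, C ^ 2 * (1 / ((i + 1 : ℕ) : ℝ) ^ 2) := by
    intro n
    induction n with
    | zero => simp [hM]
    | succ n ih =>
      have hexp : ∀ ω, M (n + 1) ω * M (n + 1) ω = M n ω * M n ω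
          + 2 / ((n : ℝ) + 1) * (M n ω * D n ω) + 1 / ((n : ℝ) + 1) ^ 2 * (D n ω * D n ω) := by
        intro ω
        rw [hMsucc]
        field_simp
        ring
      have hD2 : ∫ ω, D n ω * D n ω ∂P ≤ C ^ 2 := by
        have : ∫ _ : Ω, C ^ 2 ∂P = C ^ 2 := by simp
        rw [← this]
        refine integral_mono_ae (hD2i n) (integrable_const _) ?_
        filter_upwards [hC n] with ω hω
        rw [← abs_mul_abs_self, ← pow_two]
        exact pow_le_pow_left₀ (abs_nonneg _) hω 2
      have hi : Integrable (fun ω => M n ω * M n ω + 2 / ((n : ℝ) + 1) * (M n ω * D n ω)) P :=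
        (hM2i n).add ((hMDi n).const_mul _)
      simp only [hexp]
      rw [integral_add hi ((hD2i n).const_mul _),
        integral_add (hM2i n) ((hMDi n).const_mul _), integral_const_mul, integral_const_mul,
        horth, mul_zero, add_zero, Finset.sum_range_succ]
      refine add_le_add ih ?_
      rw [mul_comm]
      push_cast
      exact mul_le_mul_of_nonneg_right hD2 (by positivity)
  have hsummable : Summable fun i : ℕ => C ^ 2 * (1 / ((i + 1 : ℕ) : ℝ) ^ 2) :=
    ((summable_nat_add_iff 1).2 (Real.summable_one_div_nat_pow.2 one_lt_two)).mul_left _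
  set R : ℝ := 1 + ∑' i : ℕ, C ^ 2 * (1 / ((i + 1 : ℕ) : ℝ) ^ 2) with hR
  -- The bound `|x| ≤ 1 + x ^ 2` turns boundedness in `L²` into the boundedness in `L¹` needed for
  -- martingale convergence.
  have hbdd : ∀ n, eLpNorm (M n) 1 P ≤ (R.toNNReal : ℝ≥0∞) := by
    intro n
    rw [eLpNorm_one_eq_lintegral_enorm, ← ofReal_integral_norm_eq_lintegral_enorm (hMi n)]
    refine ENNReal.ofReal_le_ofReal ?_
    calc ∫ ω, ‖M n ω‖ ∂P ≤ ∫ ω, (1 + M n ω * M n ω) ∂P := by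
          refine integral_mono (hMi n).norm ((integrable_const _).add (hM2i n)) fun ω => ?_
          rw [Real.norm_eq_abs, ← abs_mul_abs_self (M n ω)]
          dsimp only
          nlinarith [sq_nonneg (|M n ω| - 1), abs_nonneg (M n ω)]
      _ = 1 + ∫ ω, M n ω * M n ω ∂P := by
          rw [integral_add (integrable_const _) (hM2i n)]; simp
      _ ≤ R := by
          rw [hR]
          refine add_le_add le_rfl ((hvar n).trans ?_)
          exact hsummable.sum_le_tsum _ fun i _ => by positivity
  filter_upwards [hmart.submartingale.exists_ae_tendsto_of_bdd hbdd] with ω ⟨c, hc⟩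
  exact tendsto_inv_mul_sum_of_tendsto_sum_div hc

end StrongLaw

/-! ### Empirical distributions evaluated on sets -/

section Empirical

variable {S : Type*} [MeasurableSpace S]

theorem empirical_apply (x : ℕ → S) (n : ℕ) {B : Set S} (hB : MeasurableSet B) :
    (empirical x n : Measure S) B
      = ((n : ℝ≥0∞) + 1)⁻¹ * ∑ i ∈ Finset.range (n + 1), B.indicator 1 (x i) := by
  simp [empirical, Measure.finsetSum_apply, hB]

theorem toReal_empirical_apply (x : ℕ → S) (n : ℕ) {B : Set S} (hB : MeasurableSet B) :
    ((empirical x n : Measure S) B).toReal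
      = ((n + 1 : ℕ) : ℝ)⁻¹ * ∑ i ∈ Finset.range (n + 1), B.indicator 1 (x i) := by
  have h : ∀ i, (B.indicator (1 : S → ℝ≥0∞) (x i)).toReal = B.indicator 1 (x i) := by
    intro i
    by_cases hi : x i ∈ B <;> simp [hi]
  have h' : ∀ i, B.indicator (1 : S → ℝ≥0∞) (x i) ≠ ∞ := by
    intro i
    by_cases hi : x i ∈ B <;> simp [hi]
  rw [empirical_apply x n hB, ENNReal.toReal_mul, ENNReal.toReal_sum fun i _ => h' i]
  simp only [h, ENNReal.toReal_inv]
  congr 2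
  rw [ENNReal.toReal_add (by simp) (by simp)]
  simp

theorem tendsto_empirical_apply {x : ℕ → S} {B : Set S} (hB : MeasurableSet B)
    {F : ProbabilityMeasure S}
    (h : Tendsto (fun n : ℕ => (n : ℝ)⁻¹ * ∑ i ∈ Finset.range n, B.indicator (1 : S → ℝ) (x i))
      atTop (𝓝 ((F : Measure S) B).toReal)) :
    Tendsto (fun n => (empirical x n : Measure S) B) atTop (𝓝 ((F : Measure S) B)) := by
  rw [← ENNReal.tendsto_toReal_iff (fun n => measure_ne_top _ _) (measure_ne_top _ _)]
  simp only [toReal_empirical_apply x _ hB]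
  -- `empirical x n` averages `n + 1` points, hence the shift by one.
  exact h.comp (tendsto_add_atTop_nat 1)

theorem measurable_empirical (n : ℕ) : Measurable fun x : ℕ → S => empirical x n := by
  refine Measurable.subtype_mk (p := fun m : Measure S => IsProbabilityMeasure m)
    (f := fun x : ℕ → S => (empirical x n : Measure S)) (h := fun x => (empirical x n).2) ?_
  refine Measure.measurable_of_measurable_coe _ fun B hB => ?_
  simp only [empirical_apply _ n hB]
  exact (Finset.measurable_fun_sum _ fun i _ =>
    (measurable_one.indicator hB).comp (measurable_pi_apply i)).const_mul _

end Empirical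

/-! ### From predictive laws to empirical laws and future blocks -/

section Predictive

variable {Ω S : Type*} [MeasurableSpace Ω] [MeasurableSpace S] {P : Measure Ω}
  [IsProbabilityMeasure P] {X : ℕ → Ω → S} {H : ℕ → Ω → ProbabilityMeasure S}
  {F : Ω → ProbabilityMeasure S}

/-- If the predictive distributions converge setwise, the empirical distributions have the same
limit. -/
theorem ae_tendsto_empirical_apply (hX : ∀ n, Measurable (X n))
    (hH : ∀ n, HasCondLaw (pastSigma X n) (X n) (fun ω => (H n ω : Measure S)) P)
    {B : Set S} (hB : MeasurableSet B)
    (hHm : ∀ n, Measurable[pastSigma X n] fun ω => (H n ω : Measure S) B)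
    (hlim : ∀ᵐ ω ∂P, Tendsto (fun n => (H n ω : Measure S) B) atTop (𝓝 ((F ω : Measure S) B))) :
    ∀ᵐ ω ∂P, Tendsto (fun n => (empirical (fun i => X i ω) n : Measure S) B) atTop
      (𝓝 ((F ω : Measure S) B)) := by
  have hind : ∀ n, StronglyMeasurable[pastSigma X (n + 1)]
      fun ω => B.indicator (1 : S → ℝ) (X n ω) := fun n =>
    ((measurable_one.indicator hB).comp (measurable_pastSigma_succ X n)).stronglyMeasurable
  have hHs : ∀ n, StronglyMeasurable[pastSigma X n] fun ω => ((H n ω : Measure S) B).toReal :=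
    fun n => (hHm n).ennreal_toReal.stronglyMeasurable
  have hle : ∀ n, pastSigma X n ≤ (inferInstance : MeasurableSpace Ω) :=
    fun n => (measurable_past hX n).comap_le
  have hindb : ∀ n ω, B.indicator (1 : S → ℝ) (X n ω) ∈ Set.Icc (0 : ℝ) 1 := by
    intro n ω
    by_cases h : X n ω ∈ B <;> simp [h]
  have hHb : ∀ n ω, ((H n ω : Measure S) B).toReal ∈ Set.Icc (0 : ℝ) 1 := fun n ω =>
    ⟨ENNReal.toReal_nonneg, ENNReal.toReal_le_of_le_ofReal zero_le_one (by simpa using prob_le_one)⟩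
  have hindi : ∀ n, Integrable (fun ω => B.indicator (1 : S → ℝ) (X n ω)) P := fun n =>
    Integrable.of_bound ((hind n).mono (hle _)).aestronglyMeasurable 1 (Eventually.of_forall
      fun ω => abs_le.2 ⟨by linarith [(hindb n ω).1], (hindb n ω).2⟩)
  have hHi : ∀ n, Integrable (fun ω => ((H n ω : Measure S) B).toReal) P := fun n =>
    Integrable.of_bound ((hHs n).mono (hle _)).aestronglyMeasurable 1 (Eventually.of_forall
      fun ω => abs_le.2 ⟨by linarith [(hHb n ω).1], (hHb n ω).2⟩)
  -- The increment is the indicator minus its predictive probability; it is known at time `n + 1`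
  -- and centred given time `n`.
  have hslln := ae_tendsto_inv_mul_sum_martingaleDifference (P := P) (𝒢 := pastFiltration hX)
    (D := fun n => (fun ω => B.indicator (1 : S → ℝ) (X n ω))
      - fun ω => ((H n ω : Measure S) B).toReal)
    (fun n => (hind n).sub ((hHs n).mono (pastSigma_mono X n.le_succ))) (C := 1)
    (fun n => Eventually.of_forall fun ω => by
      have h1 := hindb n ω
      have h2 := hHb n ω
      rw [Pi.sub_apply]
      exact abs_le.2 ⟨by linarith [h1.1, h2.2], by linarith [h1.2, h2.1]⟩)
    (fun n => by
      have h1 := condExp_sub (hindi n) (hHi n) (pastSigma X n)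
      have h2 := hH n B hB
      rw [condExp_of_stronglyMeasurable (hle n) (hHs n) (hHi n)] at h1
      refine h1.trans ?_
      filter_upwards [h2] with ω h2
      have h3 : (fun ω => B.indicator (1 : S → ℝ) (X n ω)) = (X n ⁻¹' B).indicator fun _ => 1 := rfl
      rw [Pi.sub_apply, h3, h2, measureReal_def]
      simp)
  filter_upwards [hslln, hlim] with ω h1 h2
  refine tendsto_empirical_apply hB ?_
  have h3 : Tendsto (fun n => ((H n ω : Measure S) B).toReal) atTop
      (𝓝 ((F ω : Measure S) B).toReal) :=
    (ENNReal.tendsto_toReal (measure_ne_top _ _)).comp h2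
  have h4 := h1.add h3.cesaro
  rw [zero_add] at h4
  refine h4.congr fun n => ?_
  rw [← mul_add, ← Finset.sum_add_distrib]
  simp

theorem integral_mul_prod_indicator_succ (hX : ∀ n, Measurable (X n))
    (hH : ∀ n, HasCondLaw (pastSigma X n) (X n) (fun ω => (H n ω : Measure S)) P)
    {B : Set S} (hB : MeasurableSet B) {n : ℕ} {V : Ω → ℝ}
    (hV : StronglyMeasurable[pastSigma X n] V) (hV1 : ∀ ω, |V ω| ≤ 1) :
    ∫ ω, V ω * B.indicator (1 : S → ℝ) (X n ω) ∂P
      = ∫ ω, V ω * ((H n ω : Measure S) B).toReal ∂P := by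
  have hle := (measurable_past hX n).comap_le
  have hi : Integrable ((X n ⁻¹' B).indicator fun _ => (1 : ℝ)) P :=
    (integrable_const _).indicator (hX n hB)
  have h := integral_mul_condExp_of_bounded (P := P) hle hV (Eventually.of_forall hV1) hi
  have h3 : (fun ω => B.indicator (1 : S → ℝ) (X n ω)) = (X n ⁻¹' B).indicator fun _ => 1 := rfl
  simp only [← h3] at h
  rw [← h, h3]
  refine integral_congr_ae ?_
  filter_upwards [hH n B hB] with ω hω
  rw [hω, measureReal_def]

/-- Asymptotically, the next `k` observations behave as if they were drawn independently from the
predictive distribution. -/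
theorem tendsto_integral_prod_indicator_sub (hX : ∀ n, Measurable (X n))
    (hH : ∀ n, HasCondLaw (pastSigma X n) (X n) (fun ω => (H n ω : Measure S)) P)
    {B : ℕ → Set S} (hB : ∀ i, MeasurableSet (B i))
    (hHm : ∀ n i, Measurable[pastSigma X n] fun ω => (H n ω : Measure S) (B i))
    (hlim : ∀ i, ∀ᵐ ω ∂P,
      Tendsto (fun n => (H n ω : Measure S) (B i)) atTop (𝓝 ((F ω : Measure S) (B i))))
    (k : ℕ) : ∀ W : ℕ → Ω → ℝ, (∀ n, StronglyMeasurable[pastSigma X n] (W n)) →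
      (∀ n ω, |W n ω| ≤ 1) →
      Tendsto (fun n =>
        ∫ ω, W n ω * ∏ i ∈ Finset.range k, (B i).indicator (1 : S → ℝ) (X (n + i) ω) ∂P
        - ∫ ω, W n ω * ∏ i ∈ Finset.range k, ((H n ω : Measure S) (B i)).toReal ∂P)
        atTop (𝓝 0) := by
  have hle : ∀ n, pastSigma X n ≤ (inferInstance : MeasurableSpace Ω) :=
    fun n => (measurable_past hX n).comap_le
  have hHs : ∀ n i, StronglyMeasurable[pastSigma X n]
      fun ω => ((H n ω : Measure S) (B i)).toReal := fun n i =>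
    (hHm n i).ennreal_toReal.stronglyMeasurable
  have hHb : ∀ n i ω, |((H n ω : Measure S) (B i)).toReal| ≤ 1 := fun n i ω => by
    rw [abs_of_nonneg ENNReal.toReal_nonneg]
    exact ENNReal.toReal_le_of_le_ofReal zero_le_one (by simpa using prob_le_one)
  induction k with
  | zero => intro W _ _; simp
  | succ k ih =>
    -- The last indicator is replaced by its predictive probability at time `n + k`, then by the one
    -- at time `n`. The latter is known at time `n` and joins the weight, which is why the induction
    -- quantifies over `W`.
    intro W hW hW1
    have hW' : ∀ n, StronglyMeasurable[pastSigma X n]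
        (fun ω => W n ω * ((H n ω : Measure S) (B k)).toReal) := fun n => (hW n).mul (hHs n k)
    have hW'1 : ∀ n ω, |W n ω * ((H n ω : Measure S) (B k)).toReal| ≤ 1 := fun n ω => by
      rw [abs_mul]; exact mul_le_one₀ (hW1 n ω) (abs_nonneg _) (hHb n k ω)
    have h1 := ih _ hW' hW'1
    set V : ℕ → Ω → ℝ := fun n ω =>
      W n ω * ∏ i ∈ Finset.range k, (B i).indicator (1 : S → ℝ) (X (n + i) ω) with hVdef
    have hV : ∀ n, StronglyMeasurable[pastSigma X (n + k)] (V n) := fun n =>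
      ((hW n).mono (pastSigma_mono X (Nat.le_add_right n k))).mul
        (Finset.stronglyMeasurable_fun_prod _ fun i hi =>
          ((((measurable_one.indicator (hB i)).comp (measurable_pastSigma_succ X (n + i))).mono
            (pastSigma_mono X (by have := Finset.mem_range.1 hi; omega))
            le_rfl).stronglyMeasurable))
    have hV1 : ∀ n ω, |V n ω| ≤ 1 := fun n ω => by
      rw [hVdef, abs_mul, Finset.abs_prod]
      refine mul_le_one₀ (hW1 n ω) (Finset.prod_nonneg fun _ _ => abs_nonneg _)
        (Finset.prod_le_one (fun _ _ => abs_nonneg _) fun i _ => ?_)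
      by_cases h : X (n + i) ω ∈ B i <;> simp [h]
    have hbint : ∀ {U : Ω → ℝ} {m : ℕ}, StronglyMeasurable[pastSigma X m] U → ∀ {c : ℝ},
        (∀ ω, |U ω| ≤ c) → Integrable U P := fun hU _ hc =>
      Integrable.of_bound (hU.mono (hle _)).aestronglyMeasurable _ (Eventually.of_forall hc)
    have hVH : ∀ n m, n ≤ m → Integrable (fun ω => V n ω * ((H m ω : Measure S) (B k)).toReal) P :=
      fun n m _ => by
        refine (hbint (hHs m k) (hHb m k)).bdd_mul ((hV n).mono (hle _)).aestronglyMeasurable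
          (c := 1) (Eventually.of_forall (hV1 n))
    -- Both predictive probabilities have the same almost sure limit, so freezing the time at `n`
    -- costs nothing asymptotically, by dominated convergence.
    have h2 : Tendsto (fun n => ∫ ω, (V n ω * ((H (n + k) ω : Measure S) (B k)).toReal
        - V n ω * ((H n ω : Measure S) (B k)).toReal) ∂P) atTop (𝓝 0) := by
      have h0 : ∫ _ : Ω, (0 : ℝ) ∂P = 0 := by simp
      rw [← h0]
      refine tendsto_integral_of_dominated_convergence (fun _ => 2)
        (fun n => ((hVH n _ (Nat.le_add_right n k)).sub (hVH n n le_rfl)).aestronglyMeasurable)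
        (integrable_const _) (fun n => Eventually.of_forall fun ω => ?_) ?_
      · rw [← mul_sub, Real.norm_eq_abs, abs_mul]
        have h3 := abs_sub ((H (n + k) ω : Measure S) (B k)).toReal
          ((H n ω : Measure S) (B k)).toReal
        have h4 := hHb (n + k) k ω
        have h5 := hHb n k ω
        calc _ ≤ 1 * |((H (n + k) ω : Measure S) (B k)).toReal
              - ((H n ω : Measure S) (B k)).toReal| :=
              mul_le_mul_of_nonneg_right (hV1 n ω) (abs_nonneg _)
          _ ≤ 2 := by linarith
      · filter_upwards [hlim k] with ω hω
        have h3 : Tendsto (fun n => ((H n ω : Measure S) (B k)).toReal) atTop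
            (𝓝 ((F ω : Measure S) (B k)).toReal) :=
          (ENNReal.tendsto_toReal (measure_ne_top _ _)).comp hω
        have h4 := (h3.comp (tendsto_add_atTop_nat k)).sub h3
        rw [sub_self] at h4
        refine squeeze_zero_norm (fun n => ?_) (tendsto_norm_zero.comp h4)
        rw [← mul_sub, norm_mul]
        exact mul_le_of_le_one_left (norm_nonneg _) (hV1 n ω)
    have h3 := h2.add h1
    rw [add_zero] at h3
    refine h3.congr fun n => ?_
    rw [integral_sub (hVH n _ (Nat.le_add_right n k)) (hVH n n le_rfl),
      ← integral_mul_prod_indicator_succ hX hH (hB k) (hV n) (hV1 n)]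
    have e1 : (fun ω => V n ω * (B k).indicator (1 : S → ℝ) (X (n + k) ω)) = fun ω =>
        W n ω * ∏ i ∈ Finset.range (k + 1), (B i).indicator (1 : S → ℝ) (X (n + i) ω) := by
      ext ω; rw [Finset.prod_range_succ, hVdef]; ring
    have e2 : (fun ω => V n ω * ((H n ω : Measure S) (B k)).toReal) = fun ω =>
        W n ω * ((H n ω : Measure S) (B k)).toReal
          * ∏ i ∈ Finset.range k, (B i).indicator (1 : S → ℝ) (X (n + i) ω) := by
      ext ω; rw [hVdef]; ring
    have e3 : (fun ω => W n ω * ∏ i ∈ Finset.range (k + 1), ((H n ω : Measure S) (B i)).toReal)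
        = fun ω => W n ω * ((H n ω : Measure S) (B k)).toReal
          * ∏ i ∈ Finset.range k, ((H n ω : Measure S) (B i)).toReal := by
      ext ω; rw [Finset.prod_range_succ]; ring
    rw [e1, e2, e3]
    ring

/-- The probability that the shifted sequence lies in a measurable box converges. -/
theorem tendsto_measure_box (hX : ∀ n, Measurable (X n))
    (hH : ∀ n, HasCondLaw (pastSigma X n) (X n) (fun ω => (H n ω : Measure S)) P)
    {B : ℕ → Set S} (hB : ∀ i, MeasurableSet (B i))
    (hHm : ∀ n i, Measurable[pastSigma X n] fun ω => (H n ω : Measure S) (B i))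
    (hlim : ∀ i, ∀ᵐ ω ∂P,
      Tendsto (fun n => (H n ω : Measure S) (B i)) atTop (𝓝 ((F ω : Measure S) (B i))))
    (k : ℕ) :
    Tendsto (fun n => P {ω | ∀ i ∈ Finset.range k, X (n + i) ω ∈ B i}) atTop
      (𝓝 (∫⁻ ω, ∏ i ∈ Finset.range k, (F ω : Measure S) (B i) ∂P)) := by
  have hle : ∀ n, pastSigma X n ≤ (inferInstance : MeasurableSpace Ω) :=
    fun n => (measurable_past hX n).comap_le
  have hHm' : ∀ n i, Measurable fun ω => (H n ω : Measure S) (B i) := fun n i =>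
    (hHm n i).mono (hle n) le_rfl
  have h1 := tendsto_integral_prod_indicator_sub hX hH hB hHm hlim k (fun _ _ => 1)
    (fun n => stronglyMeasurable_const) (by simp)
  simp only [one_mul] at h1
  have h2 : Tendsto (fun n => ∫⁻ ω, ∏ i ∈ Finset.range k, (H n ω : Measure S) (B i) ∂P) atTop
      (𝓝 (∫⁻ ω, ∏ i ∈ Finset.range k, (F ω : Measure S) (B i) ∂P)) := by
    refine tendsto_lintegral_of_dominated_convergence (fun _ => 1)
      (fun n => Finset.measurable_fun_prod _ fun i _ => hHm' n i)
      (fun n => Eventually.of_forall fun ω => Finset.prod_le_one' fun i _ => prob_le_one)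
      (by simp) ?_
    filter_upwards [ae_all_iff.2 hlim] with ω hω
    exact ENNReal.tendsto_finsetProd_of_ne_top _ (fun i _ => hω i) fun i _ => measure_ne_top _ _
  have hmeas : ∀ n, MeasurableSet {ω | ∀ i ∈ Finset.range k, X (n + i) ω ∈ B i} := fun n => by
    simp only [Set.ofPred_forall]
    exact Finset.measurableSet_biInter _ fun i _ => hX _ (hB i)
  have hleft : ∀ n, ∫ ω, ∏ i ∈ Finset.range k, (B i).indicator (1 : S → ℝ) (X (n + i) ω) ∂P
      = (P {ω | ∀ i ∈ Finset.range k, X (n + i) ω ∈ B i}).toReal := by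
    intro n
    rw [← measureReal_def, ← integral_indicator_one (hmeas n)]
    refine integral_congr_ae (Eventually.of_forall fun ω => ?_)
    dsimp only
    by_cases h : ∀ i ∈ Finset.range k, X (n + i) ω ∈ B i
    · rw [Set.indicator_of_mem (by exact h), Finset.prod_eq_one fun i hi => by simp [h i hi]]
      rfl
    · rw [Set.indicator_of_notMem (by exact h)]
      push Not at h
      obtain ⟨i, hi, hib⟩ := h
      exact Finset.prod_eq_zero hi (by simp [hib])
  have hpb : ∀ K : Ω → ProbabilityMeasure S, ∀ ω,
      ∏ i ∈ Finset.range k, (K ω : Measure S) (B i) ≤ 1 := fun K ω =>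
    Finset.prod_le_one' fun i _ => prob_le_one
  have hright : ∀ n, ∫ ω, ∏ i ∈ Finset.range k, ((H n ω : Measure S) (B i)).toReal ∂P
      = (∫⁻ ω, ∏ i ∈ Finset.range k, (H n ω : Measure S) (B i) ∂P).toReal := by
    intro n
    rw [← integral_toReal (Finset.measurable_fun_prod _ fun i _ => hHm' n i).aemeasurable
      (Eventually.of_forall fun ω => (hpb (H n) ω).trans_lt ENNReal.one_lt_top)]
    simp only [ENNReal.toReal_prod]
  have hfin : ∀ K : Ω → ProbabilityMeasure S,
      ∫⁻ ω, ∏ i ∈ Finset.range k, (K ω : Measure S) (B i) ∂P ≠ ∞ := fun K =>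
    ((lintegral_mono (hpb K)).trans_lt (by simp)).ne
  simp only [hleft, hright] at h1
  rw [← ENNReal.tendsto_toReal_iff (fun n => measure_ne_top _ _) (hfin F)]
  have h3 := h1.add ((ENNReal.tendsto_toReal (hfin F)).comp h2)
  rw [zero_add] at h3
  refine h3.congr fun n => ?_
  simp

end Predictive

/-! ### Laws of i.i.d. sequences -/

section PowerMeasure

variable {S : Type*} [MeasurableSpace S]

/-- The law of an i.i.d. sequence, as a kernel from probability measures. -/
noncomputable def powerKernel (S : Type*) [MeasurableSpace S] :
    Kernel (ProbabilityMeasure S) (ℕ → S) where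
  toFun F := Measure.infinitePi fun _ : ℕ => (F : Measure S)
  measurable' := by
    refine Measurable.measure_of_isPiSystem_of_isProbabilityMeasure
      generateFrom_squareCylinders.symm
      (isPiSystem_squareCylinders (fun _ => MeasurableSpace.isPiSystem_measurableSet)
        fun _ => MeasurableSet.univ) ?_
    rintro _ ⟨s, t, ht, rfl⟩
    have ht' : ∀ i, MeasurableSet (t i) := fun i => ht i (Set.mem_univ i)
    simp only [Measure.infinitePi_pi _ fun i _ => ht' i]
    exact Finset.measurable_fun_prod _ fun i _ => measurable_coe_apply (ht' i)

theorem powerKernel_apply (F : ProbabilityMeasure S) :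
    powerKernel S F = Measure.infinitePi fun _ : ℕ => (F : Measure S) := rfl

instance : IsMarkovKernel (powerKernel S) :=
  ⟨fun F => by rw [powerKernel_apply]; infer_instance⟩

/-- Distinct coordinates are independent with common law `F`. The result does not depend on `e`,
which is the source of exchangeability for mixtures. -/
theorem powerKernel_map_comp_injective (F : ProbabilityMeasure S) {n : ℕ} {e : Fin n → ℕ}
    (he : Function.Injective e) :
    (powerKernel S F).map (fun z i => z (e i)) = Measure.pi fun _ : Fin n => (F : Measure S) := by
  have h1 : iIndepFun (fun (i : ℕ) (z : ℕ → S) => z i) (powerKernel S F) :=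
    iIndepFun_infinitePi (P := fun _ : ℕ => (F : Measure S)) (X := fun _ => id)
      fun _ => measurable_id
  have h2 := h1.precomp he
  rw [iIndepFun_iff_map_fun_eq_pi_map fun i => (measurable_pi_apply (e i)).aemeasurable] at h2
  rw [h2]
  congr 1
  ext1 i
  exact Measure.infinitePi_map_eval (fun _ : ℕ => (F : Measure S)) (e i)

theorem ae_powerKernel_tendsto_empirical_apply (F : ProbabilityMeasure S) {B : Set S}
    (hB : MeasurableSet B) :
    ∀ᵐ z ∂(powerKernel S F),
      Tendsto (fun n => (empirical z n : Measure S) B) atTop (𝓝 ((F : Measure S) B)) := by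
  have hg : Measurable (B.indicator (1 : S → ℝ)) := measurable_one.indicator hB
  have heval : ∀ i, (powerKernel S F).map (fun z : ℕ → S => z i) = F := fun i =>
    Measure.infinitePi_map_eval (fun _ : ℕ => (F : Measure S)) i
  have hb : ∀ s, |B.indicator (1 : S → ℝ) s| ≤ 1 := fun s => by
    by_cases h : s ∈ B <;> simp [h]
  have hind : iIndepFun (fun (i : ℕ) (z : ℕ → S) => B.indicator (1 : S → ℝ) (z i))
      (powerKernel S F) :=
    iIndepFun_infinitePi (P := fun _ : ℕ => (F : Measure S)) (X := fun _ => B.indicator 1)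
      fun _ => hg
  have h := strong_law_ae_real (μ := powerKernel S F)
    (fun (i : ℕ) (z : ℕ → S) => B.indicator (1 : S → ℝ) (z i))
    (Integrable.of_bound (hg.comp (measurable_pi_apply 0)).aestronglyMeasurable 1
      (Eventually.of_forall fun z => hb _))
    (fun i j hij => hind.indepFun hij)
    (fun i => IdentDistrib.comp
      ⟨(measurable_pi_apply i).aemeasurable, (measurable_pi_apply 0).aemeasurable,
        (heval i).trans (heval 0).symm⟩ hg)
  have hmean : ∫ z, B.indicator (1 : S → ℝ) (z 0) ∂(powerKernel S F)
      = ((F : Measure S) B).toReal := by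
    rw [← integral_map (φ := fun z : ℕ → S => z 0) (measurable_pi_apply 0).aemeasurable
      hg.aestronglyMeasurable, heval, integral_indicator_one hB, measureReal_def]
  rw [hmean] at h
  filter_upwards [h] with z hz
  refine tendsto_empirical_apply hB (hz.congr fun n => ?_)
  rw [div_eq_inv_mul]

end PowerMeasure

/-! ### Mixtures of i.i.d. sequences and their directing measures -/

section Mixture

variable {Ω S : Type*} [MeasurableSpace Ω] [MeasurableSpace S] {P : Measure Ω}
  [IsProbabilityMeasure P] {F : Ω → ProbabilityMeasure S}

/-- A random sequence that is i.i.d. given its random distribution `F`, together with the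
underlying randomness. -/
noncomputable def jointLaw (P : Measure Ω) (hF : Measurable F) : Measure (Ω × (ℕ → S)) :=
  P ⊗ₘ (powerKernel S).comap F hF

instance (hF : Measurable F) : IsProbabilityMeasure (jointLaw P hF) := by
  unfold jointLaw; infer_instance

theorem jointLaw_fst (hF : Measurable F) : (jointLaw P hF).map Prod.fst = P :=
  Measure.fst_compProd P _

theorem jointLaw_map_snd_apply (hF : Measurable F) {A : Set (ℕ → S)} (hA : MeasurableSet A) :
    (jointLaw P hF).map Prod.snd A = ∫⁻ ω, powerKernel S (F ω) A ∂P := by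
  rw [Measure.map_apply measurable_snd hA, jointLaw, Measure.compProd_apply (measurable_snd hA)]
  rfl

theorem isExchangeable_jointLaw (hF : Measurable F) :
    IsExchangeable (fun (i : ℕ) (z : ℕ → S) => z i) ((jointLaw P hF).map Prod.snd) := by
  intro n σ
  have hm : ∀ e : Fin n → ℕ, Measurable fun (z : ℕ → S) i => z (e i) := fun e =>
    measurable_pi_iff.2 fun i => measurable_pi_apply _
  refine ⟨(hm fun i => σ i).aemeasurable, (hm fun i => i).aemeasurable, ?_⟩
  have key : ∀ e : Fin n → ℕ, Function.Injective e → ∀ A, MeasurableSet A →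
      ((jointLaw P hF).map Prod.snd).map (fun z i => z (e i)) A
        = ∫⁻ ω, Measure.pi (fun _ : Fin n => (F ω : Measure S)) A ∂P := by
    intro e he A hA
    rw [Measure.map_apply (hm e) hA, jointLaw_map_snd_apply hF (hm e hA)]
    refine lintegral_congr fun ω => ?_
    rw [← Measure.map_apply (hm e) hA, powerKernel_map_comp_injective _ he]
  ext A hA
  rw [key (fun i => σ i) (Fin.val_injective.comp σ.injective) A hA,
    key (fun i => i) Fin.val_injective A hA]

theorem ae_jointLaw_tendsto_empirical_apply (hF : Measurable F) {B : Set S}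
    (hB : MeasurableSet B) :
    ∀ᵐ p ∂(jointLaw P hF), Tendsto (fun n => (empirical p.2 n : Measure S) B) atTop
      (𝓝 ((F p.1 : Measure S) B)) := by
  refine Measure.ae_compProd_of_ae_ae ?_ (Eventually.of_forall fun ω => ?_)
  · exact measurableSet_tendsto_fun
      (fun n => (measurable_coe_apply hB).comp ((measurable_empirical n).comp measurable_snd))
      ((measurable_coe_apply hB).comp (hF.comp measurable_fst))
  · exact ae_powerKernel_tendsto_empirical_apply (F ω) hB

/-- On the joint space the empirical laws converge to `F ω`, but a directing measure must depend on
the sequence alone. Convergence of the empirical probabilities is an event of the sequence, so the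
setwise limit theorem applies under `Q` and produces `F'`; uniqueness of weak limits then identifies
`F'` with `F` on the joint space. -/
theorem exists_isDirectingMeasure_jointLaw [StandardBorelSpace S] [TopologicalSpace S]
    [TopologicalSpace.MetrizableSpace S] [SecondCountableTopology S] [BorelSpace S]
    (hF : Measurable F) :
    ∃ F' : (ℕ → S) → ProbabilityMeasure S,
      IsDirectingMeasure F' (fun (i : ℕ) (z : ℕ → S) => z i) ((jointLaw P hF).map Prod.snd) ∧
      IdentDistrib F' F ((jointLaw P hF).map Prod.snd) P := by
  set Q := (jointLaw P hF).map Prod.snd with hQ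
  have : IsProbabilityMeasure Q := Measure.isProbabilityMeasure_map measurable_snd.aemeasurable
  have hev : ∀ i : ℕ, ∀ B, MeasurableSet B →
      ∫⁻ z : ℕ → S, B.indicator 1 (z i) ∂Q = ∫⁻ ω, (F ω : Measure S) B ∂P := by
    intro i B hB
    have h1 : (fun z : ℕ → S => B.indicator (1 : S → ℝ≥0∞) (z i))
        = ((fun z : ℕ → S => z i) ⁻¹' B).indicator 1 := rfl
    rw [h1, lintegral_indicator_one (measurable_pi_apply i hB),
      jointLaw_map_snd_apply hF (measurable_pi_apply i hB)]
    refine lintegral_congr fun ω => ?_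
    rw [← Measure.map_apply (measurable_pi_apply i) hB]
    exact congrArg (fun m : Measure S => m B)
      (Measure.infinitePi_map_eval (fun _ : ℕ => (F ω : Measure S)) i)
  set κ : Kernel Ω S := ⟨fun ω => F ω, measurable_subtype_coe.comp hF⟩ with hκ
  have : IsMarkovKernel κ := ⟨fun ω => inferInstanceAs (IsProbabilityMeasure (F ω : Measure S))⟩
  obtain ⟨F', hF'm, hF't⟩ := exists_measurable_ae_tendsto_apply (P := Q) (ν := P.bind κ)
    (H := fun n z => empirical z n) measurable_empirical
    (fun n B hB => by
      simp only [empirical_apply _ n hB]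
      have hm : ∀ i, Measurable fun z : ℕ → S => B.indicator (1 : S → ℝ≥0∞) (z i) := fun i =>
        (measurable_one.indicator hB).comp (measurable_pi_apply i)
      rw [lintegral_const_mul _ (Finset.measurable_fun_sum _ fun i _ => hm i),
        lintegral_finsetSum _ fun i _ => hm i, Measure.bind_apply hB κ.measurable.aemeasurable]
      simp only [hev _ B hB, Finset.sum_const, Finset.card_range, nsmul_eq_mul]
      push_cast
      rw [← mul_assoc, ENNReal.inv_mul_cancel (by simp) (by simp), one_mul]
      rfl)
    (fun B hB => by
      have hm : ∀ n, Measurable fun z : ℕ → S => (empirical z n : Measure S) B := fun n =>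
        (measurable_coe_apply hB).comp (measurable_empirical n)
      rw [hQ, ae_map_iff measurable_snd.aemeasurable (measurableSet_exists_tendsto hm)]
      filter_upwards [ae_jointLaw_tendsto_empirical_apply hF hB] with p hp
      exact ⟨_, hp⟩)
  have hF'w := ae_tendsto_of_forall_ae_tendsto_apply hF't
  refine ⟨F', ⟨hF'm, hF'w⟩, hF'm.aemeasurable, hF.aemeasurable, ?_⟩
  have h1 : ∀ᵐ p ∂(jointLaw P hF), Tendsto (fun n => empirical p.2 n) atTop (𝓝 (F p.1)) :=
    ae_tendsto_of_forall_ae_tendsto_apply (L := fun p : Ω × (ℕ → S) => F p.1)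
      fun B hB => ae_jointLaw_tendsto_empirical_apply hF hB
  have h2 := ae_of_ae_map measurable_snd.aemeasurable hF'w
  have h3 : F' ∘ Prod.snd =ᵐ[jointLaw P hF] F ∘ Prod.fst := by
    filter_upwards [h1, h2] with p hp1 hp2
    exact tendsto_nhds_unique hp2 hp1
  rw [hQ, Measure.map_map hF'm measurable_snd, Measure.map_congr h3,
    ← Measure.map_map hF measurable_fst, jointLaw_fst]

end Mixture

/-! ### Convergence in distribution of the shifted sequences -/

section AsymptoticExchangeability

variable {Ω S : Type*} [MeasurableSpace Ω] [MeasurableSpace S] {P : Measure Ω}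
  [IsProbabilityMeasure P] {X : ℕ → Ω → S} {H : ℕ → Ω → ProbabilityMeasure S}
  {F : Ω → ProbabilityMeasure S}

theorem exists_box_eq_of_mem_squareCylinders {A : Set (ℕ → S)}
    (hA : A ∈ squareCylinders fun _ : ℕ => {s : Set S | MeasurableSet s}) :
    ∃ (k : ℕ) (B : ℕ → Set S), (∀ i, MeasurableSet (B i)) ∧
      A = (Finset.range k : Set ℕ).pi B := by
  classical
  obtain ⟨s, t, ht, rfl⟩ := hA
  -- Every index in `s` is at most its supremum; the unconstrained coordinates below the cutoff
  -- receive the whole space.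
  refine ⟨s.sup id + 1, fun i => if i ∈ s then t i else Set.univ, fun i => ?_, ?_⟩
  · dsimp only
    split_ifs
    · exact ht i (Set.mem_univ i)
    · exact MeasurableSet.univ
  · ext z
    simp only [Set.mem_pi, Finset.mem_coe, Finset.mem_range]
    constructor
    · intro h i _
      split_ifs with hi
      · exact h i hi
      · exact Set.mem_univ _
    · intro h i hi
      have := h i (Nat.lt_succ_of_le (Finset.le_sup (f := id) hi))
      rwa [if_pos hi] at this

/-- A sequence whose predictive distributions converge setwise to a random probability measure `F`
is asymptotically exchangeable with directing random measure `F`. -/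
theorem isAsymptoticallyExchangeable_of_predictive [StandardBorelSpace S] [TopologicalSpace S]
    [TopologicalSpace.MetrizableSpace S] [SecondCountableTopology S] [BorelSpace S]
    (hX : ∀ n, Measurable (X n)) (hF : Measurable F)
    (hH : ∀ n, HasCondLaw (pastSigma X n) (X n) (fun ω => (H n ω : Measure S)) P)
    (hHm : ∀ n B, MeasurableSet B → Measurable[pastSigma X n] fun ω => (H n ω : Measure S) B)
    (hlim : ∀ B, MeasurableSet B → ∀ᵐ ω ∂P,
      Tendsto (fun n => (H n ω : Measure S) B) atTop (𝓝 ((F ω : Measure S) B))) :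
    IsAsymptoticallyExchangeable X F P := by
  obtain ⟨Q, hQ⟩ : ∃ Q : ProbabilityMeasure (ℕ → S),
      (Q : Measure (ℕ → S)) = (jointLaw P hF).map Prod.snd :=
    ⟨⟨_, Measure.isProbabilityMeasure_map measurable_snd.aemeasurable⟩, rfl⟩
  refine ⟨Q, hQ ▸ isExchangeable_jointLaw hF, hQ ▸ exists_isDirectingMeasure_jointLaw hF, ?_⟩
  have hsm : ∀ n, Measurable fun ω (i : ℕ) => X (n + i) ω := fun n =>
    measurable_pi_iff.2 fun i => hX _
  refine ⟨fun n => (hsm n).aemeasurable, aemeasurable_id', ?_⟩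
  -- Weak convergence follows from convergence on measurable boxes: they form a π-system, and each
  -- point of an open set has a box neighbourhood inside it.
  refine IsPiSystem.tendsto_probabilityMeasure_of_tendsto_of_mem
    (S := squareCylinders fun _ : ℕ => {s : Set S | MeasurableSet s})
    (isPiSystem_squareCylinders (fun _ => MeasurableSpace.isPiSystem_measurableSet)
      fun _ => MeasurableSet.univ) ?_ ?_ ?_
  · intro A hA
    obtain ⟨k, B, hB, rfl⟩ := exists_box_eq_of_mem_squareCylinders hA
    exact MeasurableSet.pi (Finset.countable_toSet _) fun i _ => hB i
  · classical
    intro u hu x hx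
    obtain ⟨I, v, hv, hvu⟩ := isOpen_pi_iff.1 hu x hx
    set w : ℕ → Set S := fun i => if i ∈ I then v i else Set.univ with hw
    have hwv : (I : Set ℕ).pi w = (I : Set ℕ).pi v :=
      Set.pi_congr rfl fun i hi => by rw [hw]; exact if_pos hi
    have hwo : ∀ i, IsOpen (w i) := fun i => by
      rw [hw]; dsimp only
      split_ifs with hi
      · exact (hv i hi).1
      · exact isOpen_univ
    refine ⟨(I : Set ℕ).pi w, ⟨I, w, fun i _ => (hwo i).measurableSet, rfl⟩, ?_, ?_⟩
    · rw [hwv]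
      exact set_pi_mem_nhds I.finite_toSet fun i hi => (hv i hi).1.mem_nhds (hv i hi).2
    · rwa [hwv]
  · intro A hA
    obtain ⟨k, B, hB, rfl⟩ := exists_box_eq_of_mem_squareCylinders hA
    have hAm : MeasurableSet ((Finset.range k : Set ℕ).pi B) :=
      MeasurableSet.pi (Finset.countable_toSet _) fun i _ => hB i
    have h := tendsto_measure_box hX hH hB (fun n i => hHm n _ (hB i)) (fun i => hlim _ (hB i)) k
    have hleft : ∀ n, P.map (fun ω (i : ℕ) => X (n + i) ω) ((Finset.range k : Set ℕ).pi B)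
        = P {ω | ∀ i ∈ Finset.range k, X (n + i) ω ∈ B i} := fun n => by
      rw [Measure.map_apply (hsm n) hAm]
      rfl
    have hright : (Q : Measure (ℕ → S)).map (fun z => z) ((Finset.range k : Set ℕ).pi B)
        = ∫⁻ ω, ∏ i ∈ Finset.range k, (F ω : Measure S) (B i) ∂P := by
      rw [Measure.map_id', hQ, jointLaw_map_snd_apply hF hAm]
      refine lintegral_congr fun ω => ?_
      rw [powerKernel_apply, Measure.infinitePi_pi _ fun i _ => hB i]
    simp only [← hleft, ← hright] at h
    have hne : (Q : Measure (ℕ → S)).map (fun z => z) ((Finset.range k : Set ℕ).pi B) ≠ ∞ := by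
      rw [Measure.map_id']; exact measure_ne_top _ _
    exact (ENNReal.tendsto_toNNReal hne).comp h

end AsymptoticExchangeability

/-- Scheffé's lemma, from a lower bound for the lower limit of the densities. -/
theorem tendsto_eLpNorm_toReal_sub_of_le_liminf {S : Type*} [MeasurableSpace S] {μ : Measure S}
    {g : ℕ → S → ℝ≥0∞} {g' : S → ℝ≥0∞} (hg : ∀ n, Measurable (g n)) (hg' : Measurable g')
    (hg1 : ∀ n, ∫⁻ x, g n x ∂μ = 1) (hg'1 : ∫⁻ x, g' x ∂μ = 1)
    (hle : ∀ᵐ x ∂μ, g' x ≤ liminf (fun n => g n x) atTop) :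
    Tendsto (fun n => eLpNorm (fun x => (g n x).toReal - (g' x).toReal) 1 μ) atTop (𝓝 0) := by
  have hfin : ∀ᵐ x ∂μ, g' x < ∞ := ae_lt_top hg' (by rw [hg'1]; exact ENNReal.one_ne_top)
  have hfinn : ∀ᵐ x ∂μ, ∀ n, g n x < ∞ :=
    ae_all_iff.2 fun n => ae_lt_top (hg n) (by rw [hg1]; exact ENNReal.one_ne_top)
  have hpos : Tendsto (fun n => ∫⁻ x, (g' x - g n x) ∂μ) atTop (𝓝 0) := by
    have h0 : ∫⁻ _ : S, (0 : ℝ≥0∞) ∂μ = 0 := lintegral_zero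
    rw [← h0]
    refine tendsto_lintegral_of_dominated_convergence g' (fun n => hg'.sub (hg n))
      (fun n => Eventually.of_forall fun x => tsub_le_self)
      (by rw [hg'1]; exact ENNReal.one_ne_top) ?_
    filter_upwards [hle, hfin] with x hx hx'
    rw [ENNReal.tendsto_nhds_zero]
    intro ε hε
    rcases eq_or_ne (g' x) 0 with hz | hz
    · exact Eventually.of_forall fun n => by simp [hz]
    have hlt : g' x - ε < liminf (fun n => g n x) atTop :=
      (ENNReal.sub_lt_self hx'.ne hz hε.ne').trans_le hx
    filter_upwards [eventually_lt_of_lt_liminf hlt] with n hn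
    rw [tsub_le_iff_right]
    exact (tsub_le_iff_left.1 hn.le)
  -- Equal total masses force the positive and negative parts of the difference to have equal
  -- integrals; only the part dominated by `g'` needs a limit argument.
  have hneg : ∀ n, ∫⁻ x, (g n x - g' x) ∂μ = ∫⁻ x, (g' x - g n x) ∂μ := by
    intro n
    have h1 : ∫⁻ x, (g n x - g' x) ∂μ + 1 = ∫⁻ x, (g' x - g n x) ∂μ + 1 := by
      nth_rewrite 1 [← hg'1]
      rw [← hg1 n, ← lintegral_add_right _ hg', ← lintegral_add_right _ (hg n)]
      exact lintegral_congr fun x => by rw [tsub_add_eq_max, tsub_add_eq_max, max_comm]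
    exact (ENNReal.add_left_inj ENNReal.one_ne_top).1 h1
  have hnorm : ∀ n, eLpNorm (fun x => (g n x).toReal - (g' x).toReal) 1 μ
      = ∫⁻ x, (g' x - g n x) ∂μ + ∫⁻ x, (g' x - g n x) ∂μ := by
    intro n
    rw [eLpNorm_one_eq_lintegral_enorm]
    nth_rewrite 2 [← hneg n]
    rw [← lintegral_add_left (f := fun x => g' x - g n x) (hg'.sub (hg n))]
    refine lintegral_congr_ae ?_
    filter_upwards [hfin, hfinn] with x h1 h2
    have h2 := h2 n
    rcases le_total (g n x) (g' x) with h | h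
    · rw [tsub_eq_zero_of_le h, add_zero, ← enorm_neg, neg_sub,
        ← ENNReal.toReal_sub_of_le h h1.ne, Real.enorm_of_nonneg ENNReal.toReal_nonneg,
        ENNReal.ofReal_toReal (ENNReal.sub_ne_top h1.ne)]
    · rw [tsub_eq_zero_of_le h, zero_add,
        ← ENNReal.toReal_sub_of_le h h2.ne, Real.enorm_of_nonneg ENNReal.toReal_nonneg,
        ENNReal.ofReal_toReal (ENNReal.sub_ne_top h2.ne)]
  simp only [hnorm]
  simpa using hpos.add hpos

/-! ### Limits in Newton's model -/

section NewtonLimit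

variable {Ω 𝕏 Θ : Type*} [MeasurableSpace Ω] [MeasurableSpace 𝕏] [MeasurableSpace Θ]
  {P : Measure Ω} [IsProbabilityMeasure P] {μ : Measure 𝕏} [SigmaFinite μ] {f : 𝕏 → Θ → ℝ≥0}
  {α : ℕ → Set.Ioo (0 : ℝ) 1} {G₀ : ProbabilityMeasure Θ} {X : ℕ → Ω → 𝕏} {θ : ℕ → Ω → Θ}

/-- The law with density `f_G`. -/
noncomputable def mixtureLaw (hf : IsMixtureKernel f μ) (G : ProbabilityMeasure Θ) :
    ProbabilityMeasure 𝕏 :=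
  ⟨μ.withDensity (mixDensity f G), isProbabilityMeasure_withDensity_mixDensity hf G⟩

theorem toMeasure_mixtureLaw (hf : IsMixtureKernel f μ) (G : ProbabilityMeasure Θ) :
    (mixtureLaw hf G : Measure 𝕏) = μ.withDensity (mixDensity f G) := rfl

theorem mixtureLaw_apply (hf : IsMixtureKernel f μ) (G : ProbabilityMeasure Θ) {B : Set 𝕏}
    (hB : MeasurableSet B) :
    (mixtureLaw hf G : Measure 𝕏) B = ∫⁻ t, obsKernel f μ t B ∂(G : Measure Θ) := by
  rw [toMeasure_mixtureLaw, ← bind_obsKernel hf,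
    Measure.bind_apply hB (obsKernel f μ).measurable.aemeasurable]

theorem measurable_mixtureLaw (hf : IsMixtureKernel f μ) :
    Measurable (mixtureLaw hf : ProbabilityMeasure Θ → ProbabilityMeasure 𝕏) := by
  refine Measurable.subtype_mk (p := fun m : Measure 𝕏 => IsProbabilityMeasure m)
    (f := fun G : ProbabilityMeasure Θ => (mixtureLaw hf G : Measure 𝕏))
    (h := fun G => (mixtureLaw hf G).2) ?_
  refine Measure.measurable_of_measurable_coe _ fun B hB => ?_
  simp only [mixtureLaw_apply hf _ hB]
  exact (Measure.measurable_lintegral ((obsKernel f μ).measurable_coe hB)).comp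
    measurable_subtype_coe

theorem measurable_pastSigma_newtonSeq (hf : Measurable (Function.uncurry f)) (X : ℕ → Ω → 𝕏)
    (n : ℕ) : Measurable[pastSigma X n] fun ω => newtonSeq f α G₀ (fun i => X i ω) n := by
  simp only [newtonSeq_eq_newtonPast]
  exact (measurable_newtonPast hf α G₀ n).comp (comap_measurable fun ω (i : Fin n) => X i ω)

theorem IsNewtonModel.martingale_newtonSeq_apply (hf : IsMixtureKernel f μ)
    (hP : IsNewtonModel P μ f α G₀ X θ) {B : Set Θ} (hB : MeasurableSet B) :
    Martingale (fun n ω => ((newtonSeq f α G₀ (fun i => X i ω) n : Measure Θ) B).toReal)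
      (pastFiltration hP.measurable_obs) P := by
  have h := hP.martingale_lintegral_newtonSeq hf (φ := B.indicator 1)
    (measurable_one.indicator hB) (Set.indicator_le_self' (by simp))
  simpa only [lintegral_indicator_one hB] using h

theorem IsNewtonModel.martingale_mixtureLaw_apply (hf : IsMixtureKernel f μ)
    (hP : IsNewtonModel P μ f α G₀ X θ) {B : Set 𝕏} (hB : MeasurableSet B) :
    Martingale
      (fun n ω => ((mixtureLaw hf (newtonSeq f α G₀ (fun i => X i ω) n) : Measure 𝕏) B).toReal)
      (pastFiltration hP.measurable_obs) P := by
  have := isMarkovKernel_obsKernel hf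
  have h := hP.martingale_lintegral_newtonSeq hf (φ := fun t => obsKernel f μ t B)
    ((obsKernel f μ).measurable_coe hB) fun t => prob_le_one
  simpa only [mixtureLaw_apply hf _ hB] using h

theorem IsNewtonModel.hasCondLaw_obs [StandardBorelSpace 𝕏] (hf : IsMixtureKernel f μ)
    (hP : IsNewtonModel P μ f α G₀ X θ) (n : ℕ) :
    HasCondLaw (pastSigma X n) (X n)
      (fun ω => μ.withDensity (mixDensity f (newtonSeq f α G₀ (fun i => X i ω) n))) P := by
  have := isMarkovKernel_obsKernel hf
  have : Nonempty 𝕏 := (P.nonempty_of_neZero).map (X 0)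
  have h := hasCondLaw_of_map_eq_compProd (measurable_past hP.measurable_obs n)
    (hP.measurable_obs n) (hP.map_past_obs hf n)
  simpa only [obsKernel_comp_paramKernel_apply hf] using h

/-- Conditioning first on the past at time `n + k` gives the predictive probability at that time,
and its martingale property brings it back to time `n`. -/
theorem IsNewtonModel.hasCondLaw_obs_add [StandardBorelSpace 𝕏] (hf : IsMixtureKernel f μ)
    (hP : IsNewtonModel P μ f α G₀ X θ) (n k : ℕ) :
    HasCondLaw (pastSigma X n) (X (n + k))
      (fun ω => μ.withDensity (mixDensity f (newtonSeq f α G₀ (fun i => X i ω) n))) P := by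
  intro B hB
  have hle : pastSigma X (n + k) ≤ (inferInstance : MeasurableSpace Ω) :=
    (measurable_past hP.measurable_obs _).comap_le
  have h1 := condExp_condExp_of_le (μ := P) (f := (X (n + k) ⁻¹' B).indicator fun _ => (1 : ℝ))
    (pastSigma_mono X (Nat.le_add_right n k)) hle
  have h2 := condExp_congr_ae (m := pastSigma X n) (hP.hasCondLaw_obs hf (n + k) B hB)
  have h3 := (hP.martingale_mixtureLaw_apply hf hB).condExp_ae_eq (Nat.le_add_right n k)
  exact h1.symm.trans (h2.trans h3)

theorem IsNewtonModel.isCID [StandardBorelSpace 𝕏] (hf : IsMixtureKernel f μ)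
    (hP : IsNewtonModel P μ f α G₀ X θ) : IsCID X P := by
  refine ⟨hP.measurable_obs, fun n k h hh ⟨C, hC⟩ => ?_⟩
  have := isMarkovKernel_obsKernel hf
  have : Nonempty 𝕏 := (P.nonempty_of_neZero).map (X 0)
  have key : ∀ k, P.map (fun ω => ((fun i : Fin n => X i ω), X (n + k) ω))
      = P.map (fun ω (i : Fin n) => X i ω)
        ⊗ₘ (obsKernel f μ ∘ₖ paramKernel hf.measurable α G₀ n) := fun k => by
    refine HasCondLaw.map_eq_compProd (measurable_past hP.measurable_obs n)
      (hP.measurable_obs _) ?_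
    simpa only [obsKernel_comp_paramKernel_apply hf] using hP.hasCondLaw_obs_add hf n k
  have hc := fun k => condExp_comp_eq_of_map_eq_compProd (measurable_past hP.measurable_obs n)
    (hP.measurable_obs (n + k)) (key k) hh hC
  exact (hc k).trans (hc 0).symm

theorem ae_exists_tendsto_of_martingale_toReal {ℱ : Filtration ℕ (inferInstance : MeasurableSpace Ω)}
    {u : ℕ → Ω → ℝ≥0∞} (hu : ∀ n ω, u n ω ≤ 1)
    (hm : Martingale (fun n ω => (u n ω).toReal) ℱ P) :
    ∀ᵐ ω ∂P, ∃ c, Tendsto (fun n => u n ω) atTop (𝓝 c) := by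
  have hne : ∀ n ω, u n ω ≠ ∞ := fun n ω => ne_top_of_le_ne_top ENNReal.one_ne_top (hu n ω)
  have hb : ∀ n, eLpNorm (fun ω => (u n ω).toReal) 1 P ≤ ((1 : ℝ≥0) : ℝ≥0∞) := fun n => by
    refine (eLpNorm_le_of_ae_bound (C := 1) (Eventually.of_forall fun ω => ?_)).trans (by simp)
    rw [Real.norm_of_nonneg ENNReal.toReal_nonneg]
    exact ENNReal.toReal_le_of_le_ofReal zero_le_one (by simpa using hu n ω)
  filter_upwards [hm.submartingale.exists_ae_tendsto_of_bdd hb] with ω ⟨c, hc⟩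
  refine ⟨ENNReal.ofReal c, ?_⟩
  simpa only [ENNReal.ofReal_toReal (hne _ ω)] using ENNReal.tendsto_ofReal hc

theorem IsNewtonModel.exists_limit [StandardBorelSpace Θ] (hf : IsMixtureKernel f μ)
    (hP : IsNewtonModel P μ f α G₀ X θ) :
    ∃ G : Ω → ProbabilityMeasure Θ, Measurable G ∧ ∀ B, MeasurableSet B → ∀ᵐ ω ∂P,
      Tendsto (fun n => (newtonSeq f α G₀ (fun i => X i ω) n : Measure Θ) B) atTop
        (𝓝 ((G ω : Measure Θ) B)) := by
  refine exists_measurable_ae_tendsto_apply (ν := (G₀ : Measure Θ))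
    (fun n => measurable_newtonSeq hf.measurable hP.measurable_obs n) (fun n B hB => ?_)
    fun B hB => ae_exists_tendsto_of_martingale_toReal (fun n ω => prob_le_one)
      (hP.martingale_newtonSeq_apply hf hB)
  -- Constancy of martingale means from time zero, where the estimate is the fixed measure `G₀`,
  -- supplies the constant mean measure.
  have h := (hP.martingale_newtonSeq_apply hf hB).setIntegral_eq (Nat.zero_le n)
    (MeasurableSet.univ)
  simp only [Measure.restrict_univ] at h
  have hm : ∀ n, Measurable fun ω => (newtonSeq f α G₀ (fun i => X i ω) n : Measure Θ) B :=
    fun n => (measurable_coe_apply hB).comp (measurable_newtonSeq hf.measurable hP.measurable_obs n)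
  rw [integral_toReal (hm 0).aemeasurable (Eventually.of_forall fun _ => measure_lt_top _ _),
    integral_toReal (hm n).aemeasurable (Eventually.of_forall fun _ => measure_lt_top _ _)] at h
  have hfin : ∀ n, ∫⁻ ω, (newtonSeq f α G₀ (fun i => X i ω) n : Measure Θ) B ∂P ≠ ∞ := fun n =>
    ((lintegral_mono fun _ => prob_le_one).trans_lt (by simp : ∫⁻ _ : Ω, 1 ∂P < ∞)).ne
  rw [ENNReal.toReal_eq_toReal_iff' (hfin 0) (hfin n)] at h
  rw [← h]
  simp [newtonSeq]

theorem IsNewtonModel.ae_tendsto_eLpNorm_mixDensity (hf : IsMixtureKernel f μ)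
    (hP : IsNewtonModel P μ f α G₀ X θ) {G : Ω → ProbabilityMeasure Θ} (hG : Measurable G)
    (hlim : ∀ B, MeasurableSet B → ∀ᵐ ω ∂P,
      Tendsto (fun n => (newtonSeq f α G₀ (fun i => X i ω) n : Measure Θ) B) atTop
        (𝓝 ((G ω : Measure Θ) B))) :
    ∀ᵐ ω ∂P, Tendsto
      (fun n => eLpNorm (fun x =>
        (mixDensity f (newtonSeq f α G₀ (fun i => X i ω) n) x).toReal
          - (mixDensity f (G ω) x).toReal) 1 μ) atTop (𝓝 0) := by
  have hm := measurable_mixDensity hf.measurable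
  have hGm : Measurable fun p : Ω × 𝕏 => mixDensity f (G p.1) p.2 :=
    hm.comp ((hG.comp measurable_fst).prodMk measurable_snd)
  have hnm : ∀ n, Measurable fun p : Ω × 𝕏 =>
      mixDensity f (newtonSeq f α G₀ (fun i => X i p.1) n) p.2 := fun n =>
    hm.comp (((measurable_newtonSeq hf.measurable hP.measurable_obs n).comp
      measurable_fst).prodMk measurable_snd)
  have hset : MeasurableSet {p : Ω × 𝕏 | mixDensity f (G p.1) p.2
      ≤ liminf (fun n => mixDensity f (newtonSeq f α G₀ (fun i => X i p.1) n) p.2) atTop} :=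
    measurableSet_le hGm (Measurable.liminf hnm)
  have hae : ∀ᵐ ω ∂P, ∀ᵐ x ∂μ, mixDensity f (G ω) x
      ≤ liminf (fun n => mixDensity f (newtonSeq f α G₀ (fun i => X i ω) n) x) atTop := by
    -- Fatou's inequality holds almost surely for each fixed `x`, with a null set depending on `x`;
    -- joint measurability permits exchanging the two quantifiers.
    refine (Measure.ae_ae_comm hset).2 (Eventually.of_forall fun x => ?_)
    exact ae_lintegral_le_liminf_of_forall_ae_tendsto_apply hlim
      (hf.measurable.comp measurable_prodMk_left).coe_nnreal_ennreal
  filter_upwards [hae] with ω hω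
  exact tendsto_eLpNorm_toReal_sub_of_le_liminf (fun n => measurable_mixDensity_right hf _)
    (measurable_mixDensity_right hf _) (fun n => lintegral_mixDensity hf _)
    (lintegral_mixDensity hf _) hω

/-- If the mixing distributions converge setwise, so do the mixtures. -/
theorem ae_tendsto_mixtureLaw_apply (hf : IsMixtureKernel f μ)
    {H : ℕ → Ω → ProbabilityMeasure Θ} {G : Ω → ProbabilityMeasure Θ}
    (h : ∀ B, MeasurableSet B → ∀ᵐ ω ∂P,
      Tendsto (fun n => (H n ω : Measure Θ) B) atTop (𝓝 ((G ω : Measure Θ) B)))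
    {B : Set 𝕏} (hB : MeasurableSet B) :
    ∀ᵐ ω ∂P, Tendsto (fun n => (mixtureLaw hf (H n ω) : Measure 𝕏) B) atTop
      (𝓝 ((mixtureLaw hf (G ω) : Measure 𝕏) B)) := by
  -- Fatou bounds the lower limit on every set; on the complement this becomes a bound for the upper
  -- limit, since all masses are one.
  have key : ∀ B, MeasurableSet B → ∀ᵐ ω ∂P, (mixtureLaw hf (G ω) : Measure 𝕏) B
      ≤ liminf (fun n => (mixtureLaw hf (H n ω) : Measure 𝕏) B) atTop := fun B hB => by
    simp only [mixtureLaw_apply hf _ hB]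
    exact ae_lintegral_le_liminf_of_forall_ae_tendsto_apply h ((obsKernel f μ).measurable_coe hB)
  filter_upwards [key B hB, key Bᶜ hB.compl] with ω h1 h2
  have h3 := limsup_measure_compl_le_of_le_liminf_measure hB.compl h2
  rw [compl_compl] at h3
  exact tendsto_of_le_liminf_of_limsup_le h1 h3

end NewtonLimit

end NewtonModel

theorem mainTheorem1
    {Ω 𝕏 Θ : Type*} [MeasurableSpace Ω]
    [TopologicalSpace 𝕏] [TopologicalSpace.MetrizableSpace 𝕏] [SecondCountableTopology 𝕏]
    [MeasurableSpace 𝕏] [BorelSpace 𝕏] [StandardBorelSpace 𝕏]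
    [TopologicalSpace Θ] [TopologicalSpace.MetrizableSpace Θ] [SecondCountableTopology Θ]
    [MeasurableSpace Θ] [BorelSpace Θ] [StandardBorelSpace Θ]
    (P : Measure Ω) [IsProbabilityMeasure P]
    (μ : Measure 𝕏) [SigmaFinite μ]
    (f : 𝕏 → Θ → ℝ≥0) (hf : NewtonModel.IsMixtureKernel f μ)
    (α : ℕ → Set.Ioo (0 : ℝ) 1) (G₀ : ProbabilityMeasure Θ)
    (X : ℕ → Ω → 𝕏) (θ : ℕ → Ω → Θ)
    (hP : NewtonModel.IsNewtonModel P μ f α G₀ X θ) :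
    -- (i) the observations are conditionally identically distributed
    NewtonModel.IsCID X P ∧
    -- the predictive distribution of the next observation has density `f_{G_n}`
    (∀ n, NewtonModel.HasCondLaw (NewtonModel.pastSigma X n) (X n)
      (fun ω => μ.withDensity
        (NewtonModel.mixDensity f (NewtonModel.newtonSeq f α G₀ (fun i => X i ω) n))) P) ∧
    ∃ G : Ω → ProbabilityMeasure Θ,
      -- `G` is a random probability measure, the a.s. weak limit of `G_n`
      Measurable G ∧
      (∀ᵐ ω ∂P, Tendsto (fun n => NewtonModel.newtonSeq f α G₀ (fun i => X i ω) n)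
        atTop (𝓝 (G ω))) ∧
      -- (ii) a.s., the predictive densities converge to `f_G` in `L¹(μ)`
      (∀ᵐ ω ∂P, Tendsto
        (fun n => eLpNorm (fun x =>
          (NewtonModel.mixDensity f (NewtonModel.newtonSeq f α G₀ (fun i => X i ω) n) x).toReal
            - (NewtonModel.mixDensity f (G ω) x).toReal) 1 μ)
        atTop (𝓝 0)) ∧
      -- (iii) `X` is asymptotically exchangeable, and its directing measure has density `f_G`
      ∃ F : Ω → ProbabilityMeasure 𝕏,
        (∀ ω, (F ω : Measure 𝕏) = μ.withDensity (NewtonModel.mixDensity f (G ω))) ∧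
        NewtonModel.IsDirectingMeasure F X P ∧
        NewtonModel.IsAsymptoticallyExchangeable X F P := by
  obtain ⟨G, hG, hlim⟩ := hP.exists_limit hf
  have hF : Measurable fun ω => NewtonModel.mixtureLaw hf (G ω) :=
    (NewtonModel.measurable_mixtureLaw hf).comp hG
  have hpred : ∀ n, NewtonModel.HasCondLaw (NewtonModel.pastSigma X n) (X n)
      (fun ω => (NewtonModel.mixtureLaw hf
        (NewtonModel.newtonSeq f α G₀ (fun i => X i ω) n) : Measure 𝕏)) P := hP.hasCondLaw_obs hf
  have hadapted : ∀ n B, MeasurableSet B → Measurable[NewtonModel.pastSigma X n] fun ω =>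
      (NewtonModel.mixtureLaw hf
        (NewtonModel.newtonSeq f α G₀ (fun i => X i ω) n) : Measure 𝕏) B := fun n B hB =>
    ((NewtonModel.measurable_coe_apply hB).comp (NewtonModel.measurable_mixtureLaw hf)).comp
      (NewtonModel.measurable_pastSigma_newtonSeq hf.measurable X n)
  -- Setwise convergence of the predictive laws drives both the empirical limit and asymptotic
  -- exchangeability.
  have hFlim := fun B hB => NewtonModel.ae_tendsto_mixtureLaw_apply hf hlim (B := B) hB
  refine ⟨hP.isCID hf, hP.hasCondLaw_obs hf, G, hG,
    NewtonModel.ae_tendsto_of_forall_ae_tendsto_apply hlim,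
    hP.ae_tendsto_eLpNorm_mixDensity hf hG hlim,
    fun ω => NewtonModel.mixtureLaw hf (G ω), fun ω => rfl, ⟨hF, ?_⟩, ?_⟩
  · exact NewtonModel.ae_tendsto_of_forall_ae_tendsto_apply fun B hB =>
      NewtonModel.ae_tendsto_empirical_apply hP.measurable_obs hpred hB
        (fun n => hadapted n B hB) (hFlim B hB)
  · exact NewtonModel.isAsymptoticallyExchangeable_of_predictive hP.measurable_obs hF hpred
      hadapted hFlim
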